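/- For every sample size $n$ let $\mathbf y_t = A\,\mathbf y_{t-1}+\mathbf e_t$ ($t\ge 1$) be a stationary $p$-dimensional Gaussian VAR(1) process ($p=p_n$, $A=A_n$, $\Sigma_{\mathbf e}=\Sigma_{\mathbf e,n}$ may vary with $n$): all complex eigenvalues of $A$ have modulus $<1$, the $\mathbf e_t$ are i.i.d. $\mathcal N_p(0,\Sigma_{\mathbf e})$ and independent of $\mathbf y_0$, and all $\mathbf y_t$ have the same law. Let $f(\theta)=\frac1{2\pi}(I-e^{-i\theta}A)^{-1}\Sigma_{\mathbf e}\big((I-e^{-i\theta}A)^{-1}\big)^{*}$ be the spectral density, and assume that, for constants $c_0,C_0>0$ not depending on $n$, $$\Lambda_{\min}(\Sigma_{\mathbf e})\ge c_0,\qquad \Lambda_{\max}(f(\theta))\le C_0\quad\text{for all }\theta\in\mathbb R .$$ Let $\Sigma=E(\mathbf y_0\mathbf y_0^{\mathsf T})$, let $\mathbf X=(\mathbf y_0,\dots,\mathbf y_{n-1})^{\mathsf T}$, with $j$-th column $X_j$ and remaining columns $\mathbf X_{-j}$. For $j=1,\dots,p$ let $\gamma_j=\Sigma_{-j,-j}^{-1}\Sigma_{-j,j}$,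 let $q_j$ be the number of nonzero entries of $\gamma_j$, and let $$\hat\gamma_j\in\operatorname*{argmin}_{\gamma\in\mathbb R^{p-1}}\big\{\|X_j-\mathbf X_{-j}\gamma\|_2^2/n+2\lambda_j\|\gamma\|_1\big\}$$ be any nodewise Lasso estimate with tuning parameter $\lambda_j=\lambda_{j,n}$. There is a constant $\kappa>0$, depending only on $c_0$ and $C_0$, such that the following holds. Assume that $\lambda_j\asymp\sqrt{\log p/n}$ with a sufficiently large constant, that is, for some $K<\infty$ and all large $n$, $$\kappa\sqrt{\log p/n}\le\lambda_j\le K\sqrt{\log p/n}\qquad\text{for all } j=1,\dots,p,$$ and that $\max_j q_j\log p/\sqrt n\to0$. Then, as $n\to\infty$, $$\|\hat\gamma_j-\gamma_j\|_1=O_p\big(q_j\sqrt{\log p/n}\big),\qquad \|\mathbf X_{-j}(\hat\gamma_j-\gamma_j)\|_2^2/n=O_p\big(q_j\log p/n\big),$$ uniformly over all $j$ with $q_j\ge1$, and, if $p\to\infty$, uniformly over all $j=1,\dots,p$. Here $Z_{n,j}=O_p(b_{n,j})$ uniformly over $j\in J_n$ means: for every $\varepsilon>0$ there is $M>0$ such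 that, for all large $n$ and all $j\in J_n$, $P(|Z_{n,j}|>M b_{n,j})\le\varepsilon$. -/

import Mathlib

open MeasureTheory ProbabilityTheory Filter Topology
open scoped ComplexOrder

noncomputable section

/-- A VAR(1) transition matrix is stable if all its complex eigenvalues have modulus `< 1`. -/
def IsStableMatrix {p : ℕ} (A : Matrix (Fin p) (Fin p) ℝ) : Prop :=
  ∀ z ∈ spectrum ℂ (A.map (fun a : ℝ => (a : ℂ))), ‖z‖ < 1

/-- The stationary Gaussian VAR(1) model `y_{t+1} = A y_t + e_{t+1}`, `t = 0, 1, 2, …`: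
the noise vectors `e_1, e_2, …` are i.i.d. `N(0, S)` and independent of `y_0`, the transition
matrix is stable, and all the `y_t` have the same law. (The vector `e_0` plays no role.) -/
structure IsStationaryGaussianVAR {Ω : Type*} [MeasurableSpace Ω] (P : Measure Ω) {p : ℕ}
    (A S : Matrix (Fin p) (Fin p) ℝ) (y e : ℕ → Ω → EuclideanSpace ℝ (Fin p)) : Prop where
  isProb : IsProbabilityMeasure P
  measurable_y : ∀ t, Measurable (y t)
  measurable_e : ∀ t, Measurable (e t)
  stable : IsStableMatrix A
  noise_cov : S.PosSemidef
  noise_law : ∀ t, P.map (e (t + 1)) = multivariateGaussian 0 S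
  noise_indep : iIndepFun (fun t => e (t + 1)) P
  initial_indep : IndepFun (y 0) (fun ω t => e (t + 1) ω) P
  recursion : ∀ t, ∀ᵐ ω ∂P, ∀ i, y (t + 1) ω i = (∑ k, A i k * y t ω k) + e (t + 1) ω i
  stationary : ∀ t, IdentDistrib (y t) (y 0) P P

/-- The spectral density at frequency `θ` of the VAR(1) process with transition matrix `A` and
noise covariance `S`: `(2π)⁻¹ (I - e^{-iθ} A)⁻¹ S ((I - e^{-iθ} A)⁻¹)ᴴ`. -/
def varSpectralDensity {p : ℕ} (A S : Matrix (Fin p) (Fin p) ℝ) (θ : ℝ) :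
    Matrix (Fin p) (Fin p) ℂ :=
  let T : Matrix (Fin p) (Fin p) ℂ :=
    (1 - Complex.exp (-(θ * Complex.I)) • A.map (fun a : ℝ => (a : ℂ)))⁻¹
  ((2 * Real.pi : ℝ) : ℂ)⁻¹ • (T * S.map (fun a : ℝ => (a : ℂ)) * T.conjTranspose)

/-- `Σ = E (y_0 y_0ᵀ)`, which is `E (y_t y_tᵀ)` for every `t` by stationarity. -/
def secondMoment {Ω : Type*} [MeasurableSpace Ω] (P : Measure Ω) {p : ℕ}
    (y : ℕ → Ω → EuclideanSpace ℝ (Fin p)) : Matrix (Fin p) (Fin p) ℝ :=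
  Matrix.of fun i k => ∫ ω, y 0 ω i * y 0 ω k ∂P

/-- The nodewise regression vector `γ_j = Σ_{-j,-j}⁻¹ Σ_{-j,j}`. -/
def nodewiseCoef {p : ℕ} (Sig : Matrix (Fin p) (Fin p) ℝ) (j : Fin p) : {k // k ≠ j} → ℝ :=
  Matrix.mulVec
    (Sig.submatrix (Subtype.val : {k // k ≠ j} → Fin p) (Subtype.val : {k // k ≠ j} → Fin p))⁻¹
    (fun k => Sig k.1 j)

/-- The sparsity `q_j`, the number of nonzero entries of `γ_j`. -/
def nodewiseSparsity {p : ℕ} (Sig : Matrix (Fin p) (Fin p) ℝ) (j : Fin p) : ℕ :=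
  Set.ncard {k : {k // k ≠ j} | nodewiseCoef Sig j k ≠ 0}

/-- The design matrix `X = (y_0, …, y_{n-1})ᵀ` at the sample point `ω`. -/
def designMatrix {Ω : Type*} {p : ℕ} (n : ℕ) (y : ℕ → Ω → EuclideanSpace ℝ (Fin p)) (ω : Ω) :
    Matrix (Fin n) (Fin p) ℝ :=
  Matrix.of fun t k => y t ω k

/-- The fit `X_{-j} g`. -/
def nodewiseFit {n p : ℕ} (X : Matrix (Fin n) (Fin p) ℝ) (j : Fin p) (g : {k // k ≠ j} → ℝ) :
    Fin n → ℝ :=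
  Matrix.mulVec (X.submatrix id Subtype.val) g

/-- The nodewise Lasso objective `‖X_j - X_{-j} g‖₂² / n + 2 l ‖g‖₁`. -/
def nodewiseObjective {n p : ℕ} (X : Matrix (Fin n) (Fin p) ℝ) (j : Fin p) (l : ℝ)
    (g : {k // k ≠ j} → ℝ) : ℝ :=
  (∑ t, (X t j - nodewiseFit X j g t) ^ 2) / n + 2 * l * ∑ k, |g k|

/-- `g` is a nodewise Lasso estimate: a global minimizer of the objective. -/
def IsNodewiseLasso {n p : ℕ} (X : Matrix (Fin n) (Fin p) ℝ) (j : Fin p) (l : ℝ)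
    (g : {k // k ≠ j} → ℝ) : Prop :=
  ∀ g' : {k // k ≠ j} → ℝ, nodewiseObjective X j l g ≤ nodewiseObjective X j l g'

/-- `Z_{n,j} = O_p (b_{n,j})` as `n → ∞`, uniformly over the indices `j ∈ J_n`. -/
def IsBigOpOn {Ω : ℕ → Type*} [∀ n, MeasurableSpace (Ω n)] (P : ∀ n, Measure (Ω n)) {p : ℕ → ℕ}
    (J : ∀ n, Set (Fin (p n))) (Z : ∀ n, Fin (p n) → Ω n → ℝ) (b : ∀ n, Fin (p n) → ℝ) : Prop :=
  ∀ ε : ℝ, 0 < ε → ∃ M : ℝ, 0 < M ∧ ∀ᶠ n in atTop, ∀ j ∈ J n,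
    P n {ω | M * b n j < |Z n j ω|} ≤ ENNReal.ofReal ε

end

/-! The probabilistic core is that a linear functional `∑ w_t · y_t` of the observations is centred
Gaussian with variance at most `2πC₀ ∑ |w_t|²` (`IsStationaryGaussianVAR.map_sum_dotProduct`).
Unrolling the recursion backwards writes it as an initial term plus independent noise terms whose
coefficients come out of a linear filter driven by `Aᵀ`; its variance is the total output energy of
that filter in the metric of `S`. By Parseval this energy is an average over frequencies, where the
gain of the filter is `2π f(θ)` (`periodic_filter_energy_le`). Stability makes the passage from a
periodic to a one-sided filter harmless.

Hence `(u · y_t)_{t<n}` is a Gaussian vector with covariance at most `2πC₀|u|²`. Rotating it to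
independent coordinates gives chi-square type concentration for `∑ (u · y_t)²`, and polarization
gives the same for products. Applied to pairs of coordinates this controls the Gram matrix; applied
to a coordinate and the population residual, which are uncorrelated by the normal equations, it
controls the noise of the nodewise regression. The eigenvalues of `Σ` lie between `c₀` and `2πC₀`,
so the residual direction has bounded norm.

The Lasso part is deterministic, and two regimes are needed because `κ` may not depend on the target
probability `ε`. For `p ≥ p₀(ε)` the noise is below `λ_j/2` with probability close to one and the
usual cone argument applies (`nodewise_rate_of_noise_le`); if `q_j = 0` it forces the error to
vanish exactly. For `p < p₀` the noise is only known to be of order `√(log p / n)`, with a constant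
depending on `ε`. The dimension is then bounded, so Cauchy–Schwarz with `√p` replaces the cone
condition (`nodewise_rate_of_dim`), and `q_j ≥ 1` allows the bounded factor to be absorbed in the
rate. `measure_nodewise_rate_le` joins the two. -/

/-! ### Frequency-domain energy bound for periodic filters. -/

/-- Parseval's identity for the discrete Fourier transform of two sequences of length `N`. -/
lemma sum_star_dft_mul_dft {N : ℕ} {ζ : ℂ} (hζ : IsPrimitiveRoot ζ N) (hn : ‖ζ‖ = 1)
    (f g : ℕ → ℂ) :
    ∑ l ∈ Finset.range N, star (∑ k ∈ Finset.range N, (ζ ^ l) ^ k * f k) *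
        (∑ k ∈ Finset.range N, (ζ ^ l) ^ k * g k)
      = N * ∑ k ∈ Finset.range N, star (f k) * g k := by
  have hinv : star ζ = ζ⁻¹ := by
    rw [Complex.star_def, Complex.inv_def, Complex.normSq_eq_norm_sq, hn]; simp
  have hζ0 : ζ ≠ 0 := by rintro rfl; simp at hn
  have horth : ∀ k ∈ Finset.range N, ∀ k' ∈ Finset.range N,
      ∑ l ∈ Finset.range N, star ((ζ ^ l) ^ k) * (ζ ^ l) ^ k' = if k = k' then (N : ℂ) else 0 := by
    intro k hk k' hk'
    have hrw : ∀ l, star ((ζ ^ l) ^ k) * (ζ ^ l) ^ k' = ((ζ ^ k)⁻¹ * ζ ^ k') ^ l := by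
      intro l
      rw [star_pow, star_pow, hinv, mul_pow, inv_pow, inv_pow, inv_pow, ← pow_mul, ← pow_mul,
        ← pow_mul, ← pow_mul, mul_comm l k, mul_comm l k']
    simp_rw [hrw]
    split_ifs with h
    · subst h
      simp [hζ0]
    · have hne : (ζ ^ k)⁻¹ * ζ ^ k' ≠ 1 := by
        intro h1
        rw [inv_mul_eq_one₀ (pow_ne_zero _ hζ0)] at h1
        exact h (hζ.pow_inj (Finset.mem_range.1 hk) (Finset.mem_range.1 hk') h1)
      rw [geom_sum_eq hne, mul_pow, inv_pow, ← pow_mul, ← pow_mul, mul_comm k, mul_comm k',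
        pow_mul, pow_mul, hζ.pow_eq_one]
      simp
  calc _ = ∑ l ∈ Finset.range N, ∑ k ∈ Finset.range N, ∑ k' ∈ Finset.range N,
        (star ((ζ ^ l) ^ k) * (ζ ^ l) ^ k') * (star (f k) * g k') := by
        refine Finset.sum_congr rfl fun l _ => ?_
        rw [star_sum, Finset.sum_mul_sum]
        refine Finset.sum_congr rfl fun k _ => Finset.sum_congr rfl fun k' _ => ?_
        rw [star_mul']; ring
    _ = ∑ k ∈ Finset.range N, ∑ k' ∈ Finset.range N,
        (if k = k' then (N : ℂ) else 0) * (star (f k) * g k') := by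
        rw [Finset.sum_comm]
        refine Finset.sum_congr rfl fun k hk => ?_
        rw [Finset.sum_comm]
        refine Finset.sum_congr rfl fun k' hk' => ?_
        rw [← Finset.sum_mul, horth k hk k' hk']
    _ = _ := by
        rw [Finset.mul_sum]
        refine Finset.sum_congr rfl fun k hk => ?_
        simp only [ite_mul, zero_mul, Finset.sum_ite_eq]
        rw [if_pos hk]

/-- The frequency response bound: if `x = z A^T x + v` with `z = e^{iθ}`, then
`x^* S x ≤ 2π C |v|²`. -/
lemma frequency_response_le {p : ℕ} {A S : Matrix (Fin p) (Fin p) ℝ} {C θ : ℝ}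
    (hu : IsUnit (1 - Complex.exp (-(θ * Complex.I)) • A.map (fun a : ℝ => (a : ℂ))))
    (hf : ((C : ℂ) • (1 : Matrix (Fin p) (Fin p) ℂ) - varSpectralDensity A S θ).PosSemidef)
    {x v : Fin p → ℂ}
    (hx : x = Complex.exp (θ * Complex.I) • (A.map (fun a : ℝ => (a : ℂ))).transpose.mulVec x + v) :
    (star x ⬝ᵥ (S.map (fun a : ℝ => (a : ℂ))).mulVec x).re
      ≤ 2 * Real.pi * C * (star v ⬝ᵥ v).re := by
  set B := 1 - Complex.exp (-(θ * Complex.I)) • A.map (fun a : ℝ => (a : ℂ)) with hB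
  have hBs : B.conjTranspose = 1 - Complex.exp (θ * Complex.I) •
      (A.map (fun a : ℝ => (a : ℂ))).transpose := by
    rw [hB, Matrix.conjTranspose_sub, Matrix.conjTranspose_one, Matrix.conjTranspose_smul]
    congr 2
    · rw [Complex.star_def, ← Complex.exp_conj]; simp
    · ext i j; simp [Matrix.conjTranspose_apply]
  have hv : B.conjTranspose.mulVec x = v := by
    rw [hBs, Matrix.sub_mulVec, Matrix.one_mulVec, Matrix.smul_mulVec]
    nth_rw 1 [hx]; simp
  have hdet : IsUnit B.det := (Matrix.isUnit_iff_isUnit_det _).1 hu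
  have hdet' : IsUnit B.conjTranspose.det := by
    rw [Matrix.det_conjTranspose]; exact hdet.star
  have hxv : x = (B⁻¹).conjTranspose.mulVec v := by
    rw [← hv, Matrix.mulVec_mulVec, Matrix.conjTranspose_nonsing_inv,
      Matrix.nonsing_inv_mul _ hdet', Matrix.one_mulVec]
  -- Since `x = (B⁻¹)ᴴ v`, the quadratic form of the spectral density at `v` is `(2π)⁻¹ xᴴ S x`, so
  -- the claim is its upper bound tested on `v`.
  have h := hf.dotProduct_mulVec_nonneg v
  have hfd : varSpectralDensity A S θ = ((2 * Real.pi : ℝ) : ℂ)⁻¹ •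
      (B⁻¹ * S.map (fun a : ℝ => (a : ℂ)) * (B⁻¹).conjTranspose) := rfl
  have hq : star v ⬝ᵥ (B⁻¹ * S.map (fun a : ℝ => (a : ℂ)) * (B⁻¹).conjTranspose).mulVec v
      = star x ⬝ᵥ (S.map (fun a : ℝ => (a : ℂ))).mulVec x := by
    rw [mul_assoc, ← Matrix.mulVec_mulVec, ← Matrix.mulVec_mulVec, ← hxv, Matrix.dotProduct_mulVec]
    congr 1
    rw [hxv, Matrix.star_mulVec, Matrix.conjTranspose_conjTranspose]
  rw [Matrix.sub_mulVec, dotProduct_sub, Matrix.smul_mulVec, Matrix.one_mulVec, hfd,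
    Matrix.smul_mulVec, dotProduct_smul, dotProduct_smul, hq] at h
  have h' := (Complex.le_def.1 h).1
  rw [Complex.zero_re, Complex.sub_re, smul_eq_mul, smul_eq_mul, Complex.re_ofReal_mul,
    ← Complex.ofReal_inv, Complex.re_ofReal_mul] at h'
  have hpi : 0 < 2 * Real.pi := by positivity
  have := mul_le_mul_of_nonneg_left (sub_nonneg.1 h') hpi.le
  rwa [← mul_assoc, mul_inv_cancel₀ hpi.ne', one_mul, ← mul_assoc] at this

/-- The energy of the output of the periodic filter `c_{k+1} = A^T c_k + v_{k+1}`, measured by the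
noise covariance `S`, is at most `2π C` times the energy of the input. -/
lemma periodic_filter_energy_le {p : ℕ} {A S : Matrix (Fin p) (Fin p) ℝ} {C : ℝ}
    (hu : ∀ θ : ℝ, IsUnit (1 - Complex.exp (-(θ * Complex.I)) • A.map (fun a : ℝ => (a : ℂ))))
    (hf : ∀ θ : ℝ, ((C : ℂ) • (1 : Matrix (Fin p) (Fin p) ℂ)
      - varSpectralDensity A S θ).PosSemidef)
    (m : ℕ) (c v : ℕ → Fin p → ℝ) (h0 : c 0 = A.transpose.mulVec (c m) + v 0)
    (hs : ∀ k < m, c (k + 1) = A.transpose.mulVec (c k) + v (k + 1)) :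
    ∑ k ∈ Finset.range (m + 1), c k ⬝ᵥ S.mulVec (c k)
      ≤ 2 * Real.pi * C * ∑ k ∈ Finset.range (m + 1), v k ⬝ᵥ v k := by
  set N := m + 1 with hN
  have hN0 : (N : ℂ) ≠ 0 := by rw [hN]; exact_mod_cast Nat.succ_ne_zero m
  set ζ : ℂ := Complex.exp (2 * Real.pi * Complex.I / N) with hζd
  have hζ : IsPrimitiveRoot ζ N := Complex.isPrimitiveRoot_exp N (by omega)
  have hζ' : ∀ l : ℕ, ζ ^ l = Complex.exp (((2 * Real.pi * l / N : ℝ) : ℂ) * Complex.I) := by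
    intro l
    rw [hζd, ← Complex.exp_nat_mul]; congr 1; push_cast; ring
  have hn : ‖ζ‖ = 1 := hζ.norm'_eq_one (by omega)
  set cc : ℕ → Fin p → ℂ := fun k i => (c k i : ℂ)
  set vv : ℕ → Fin p → ℂ := fun k i => (v k i : ℂ)
  set F : (ℕ → Fin p → ℂ) → ℕ → Fin p → ℂ :=
    fun w l i => ∑ k ∈ Finset.range N, (ζ ^ l) ^ k * w k i with hF
  set At := (A.map (fun a : ℝ => (a : ℂ))).transpose with hAt
  have hAc : ∀ k i, At.mulVec (cc k) i = ((A.transpose.mulVec (c k) i : ℝ) : ℂ) := by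
    intro k i
    simp [Matrix.mulVec, dotProduct, hAt, cc]
  -- The transform turns the shift into multiplication by `z = ζ ^ l`; the wrap-around from `c m` to
  -- `c 0` fits because `z ^ N = 1`.
  have hrec : ∀ l, F cc l = Complex.exp (((2 * Real.pi * l / N : ℝ) : ℂ) * Complex.I) •
      At.mulVec (F cc l) + F vv l := by
    intro l
    rw [← hζ']
    set z := ζ ^ l with hz
    have hzN : z ^ N = 1 := by rw [hz, ← pow_mul, mul_comm, pow_mul, hζ.pow_eq_one, one_pow]
    have hmv : At.mulVec (F cc l) = fun i => ∑ k ∈ Finset.range N, z ^ k * At.mulVec (cc k) i := by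
      ext i
      simp only [Matrix.mulVec, dotProduct, hF, Finset.mul_sum]
      rw [Finset.sum_comm]
      refine Finset.sum_congr rfl fun k _ => Finset.sum_congr rfl fun j _ => by ring
    ext i
    simp only [Pi.add_apply, Pi.smul_apply, smul_eq_mul, hmv]
    simp only [hF, ← hz, hN]
    rw [Finset.sum_range_succ' (fun k => z ^ k * cc k i),
      Finset.sum_range_succ' (fun k => z ^ k * vv k i),
      Finset.sum_range_succ (fun k => z ^ k * At.mulVec (cc k) i), mul_add, Finset.mul_sum]
    have h1 : ∑ k ∈ Finset.range m, z ^ (k + 1) * cc (k + 1) i =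
        ∑ k ∈ Finset.range m, z * (z ^ k * At.mulVec (cc k) i)
          + ∑ k ∈ Finset.range m, z ^ (k + 1) * vv (k + 1) i := by
      rw [← Finset.sum_add_distrib]
      refine Finset.sum_congr rfl fun k hk => ?_
      have : cc (k + 1) i = At.mulVec (cc k) i + vv (k + 1) i := by
        rw [hAc]; simp only [cc, vv]; rw [hs k (Finset.mem_range.1 hk)]; simp
      rw [this]; ring
    have h2 : cc 0 i = At.mulVec (cc m) i + vv 0 i := by
      rw [hAc]; simp only [cc, vv]; rw [h0]; simp
    have h3 : z * (z ^ m * At.mulVec (cc m) i) = At.mulVec (cc m) i := by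
      rw [← mul_assoc, ← pow_succ', ← hN, hzN, one_mul]
    rw [h1, h2, h3]; ring
  have hfr : ∀ l, (star (F cc l) ⬝ᵥ (S.map (fun a : ℝ => (a : ℂ))).mulVec (F cc l)).re
      ≤ 2 * Real.pi * C * (star (F vv l) ⬝ᵥ F vv l).re := fun l =>
    frequency_response_le (hu _) (hf _) (hrec l)
  have hpar : ∀ (w w' : ℕ → Fin p → ℝ) (i j : Fin p),
      ∑ l ∈ Finset.range N, star (F (fun k i => (w k i : ℂ)) l i) * F (fun k i => (w' k i : ℂ)) l j
        = ((N * ∑ k ∈ Finset.range N, w k i * w' k j : ℝ) : ℂ) := by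
    intro w w' i j
    rw [hF, sum_star_dft_mul_dft hζ hn]
    simp
  have hS : ∑ l ∈ Finset.range N, star (F cc l) ⬝ᵥ (S.map (fun a : ℝ => (a : ℂ))).mulVec (F cc l)
      = ((N * ∑ k ∈ Finset.range N, c k ⬝ᵥ S.mulVec (c k) : ℝ) : ℂ) := by
    have : ∀ l, star (F cc l) ⬝ᵥ (S.map (fun a : ℝ => (a : ℂ))).mulVec (F cc l)
        = ∑ i, ∑ j, (S i j : ℂ) * (star (F cc l i) * F cc l j) := by
      intro l
      simp only [dotProduct, Matrix.mulVec, Finset.mul_sum, Pi.star_apply, Matrix.map_apply]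
      refine Finset.sum_congr rfl fun i _ => Finset.sum_congr rfl fun j _ => by ring
    simp_rw [this]
    rw [Finset.sum_comm]
    have h2 : ∀ i, ∑ l ∈ Finset.range N, ∑ j, (S i j : ℂ) * (star (F cc l i) * F cc l j)
        = ∑ j, (S i j : ℂ) * ((N * ∑ k ∈ Finset.range N, c k i * c k j : ℝ) : ℂ) := by
      intro i
      rw [Finset.sum_comm]
      refine Finset.sum_congr rfl fun j _ => ?_
      rw [← Finset.mul_sum, hpar c c i j]
    simp_rw [h2, ← Complex.ofReal_mul, ← Complex.ofReal_sum]
    congr 1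
    have h3 : ∀ k, c k ⬝ᵥ S.mulVec (c k) = ∑ i, ∑ j, S i j * (c k i * c k j) := by
      intro k
      simp only [dotProduct, Matrix.mulVec, Finset.mul_sum]
      refine Finset.sum_congr rfl fun i _ => Finset.sum_congr rfl fun j _ => by ring
    simp_rw [h3]
    have h4 : ∑ k ∈ Finset.range N, ∑ i, ∑ j, S i j * (c k i * c k j)
        = ∑ i, ∑ j, S i j * ∑ k ∈ Finset.range N, c k i * c k j := by
      rw [Finset.sum_comm]
      refine Finset.sum_congr rfl fun i _ => ?_
      rw [Finset.sum_comm]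
      simp_rw [Finset.mul_sum]
    rw [h4, Finset.mul_sum]
    refine Finset.sum_congr rfl fun i _ => ?_
    rw [Finset.mul_sum]
    refine Finset.sum_congr rfl fun j _ => by ring
  have hV : ∑ l ∈ Finset.range N, star (F vv l) ⬝ᵥ F vv l
      = ((N * ∑ k ∈ Finset.range N, v k ⬝ᵥ v k : ℝ) : ℂ) := by
    simp only [dotProduct, Pi.star_apply]
    rw [Finset.sum_comm]
    simp_rw [vv, hpar v v, ← Complex.ofReal_sum]
    congr 1
    rw [← Finset.mul_sum]
    congr 1
    exact Finset.sum_comm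
  have hsum := Finset.sum_le_sum fun l (_ : l ∈ Finset.range N) => hfr l
  rw [← Finset.mul_sum, ← Complex.re_sum, ← Complex.re_sum, hS, hV, Complex.ofReal_re,
    Complex.ofReal_re] at hsum
  have hNpos : (0 : ℝ) < N := by rw [hN]; exact_mod_cast Nat.succ_pos m
  refine le_of_mul_le_mul_left ?_ hNpos
  linarith

/-! ### Consequences of stability. -/

section MatrixPowers

attribute [local instance] Matrix.linftyOpNormedRing Matrix.linftyOpNormedAlgebra

/-- In a complex Banach algebra, the powers of an element of spectral radius `< 1` tend to `0`. -/
lemma tendsto_pow_of_spectralRadius_lt_one {R : Type*} [NormedRing R] [NormedAlgebra ℂ R]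
    [CompleteSpace R] {a : R} (h : spectralRadius ℂ a < 1) :
    Tendsto (fun n : ℕ => a ^ n) atTop (𝓝 0) := by
  obtain ⟨r, hr1, hr2⟩ := ENNReal.lt_iff_exists_nnreal_btwn.1 h
  have hr2' : (r : ℝ) < 1 := by exact_mod_cast hr2
  -- Gelfand's formula: `‖a ^ n‖ ≤ r ^ n` eventually, for some `r < 1` above the spectral radius.
  have hg := (spectrum.pow_nnnorm_pow_one_div_tendsto_nhds_spectralRadius a).eventually_lt_const hr1
  refine squeeze_zero_norm' ?_ (tendsto_pow_atTop_nhds_zero_of_lt_one r.2 hr2')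
  filter_upwards [hg, eventually_gt_atTop 0] with n hn hn0
  have h1 : (‖a ^ n‖₊ : ENNReal) ≤ (r : ENNReal) ^ n := by
    have := ENNReal.rpow_le_rpow hn.le (Nat.cast_nonneg (α := ℝ) n)
    rw [← ENNReal.rpow_mul, one_div, inv_mul_cancel₀ (by positivity), ENNReal.rpow_one,
      ENNReal.rpow_natCast] at this
    exact this
  exact_mod_cast h1

lemma IsStableMatrix.tendsto_pow_apply {p : ℕ} {A : Matrix (Fin p) (Fin p) ℝ}
    (hA : IsStableMatrix A) (i j : Fin p) : Tendsto (fun n : ℕ => (A ^ n) i j) atTop (𝓝 0) := by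
  have : Nonempty (Fin p) := ⟨i⟩
  have : CompleteSpace (Matrix (Fin p) (Fin p) ℂ) := FiniteDimensional.complete ℂ _
  have h := tendsto_pow_of_spectralRadius_lt_one (a := A.map (fun a : ℝ => (a : ℂ)))
    (spectrum.spectralRadius_lt_of_forall_lt _ (r := 1) fun z hz => by exact_mod_cast hA z hz)
  have hpow : ∀ n : ℕ, A.map (fun a : ℝ => (a : ℂ)) ^ n = (A ^ n).map (fun a : ℝ => (a : ℂ)) :=
    fun n => (map_pow Complex.ofRealHom.mapMatrix A n).symm
  have hc : Continuous fun M : Matrix (Fin p) (Fin p) ℂ => (M i j).re :=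
    Complex.continuous_re.comp (continuous_apply_apply (ρ := fun _ _ => ℂ) i j)
  simpa [Function.comp_def, hpow] using (hc.tendsto 0).comp h

lemma IsStableMatrix.tendsto_transpose_pow_mulVec {p : ℕ} {A : Matrix (Fin p) (Fin p) ℝ}
    (hA : IsStableMatrix A) (u : Fin p → ℝ) :
    Tendsto (fun n : ℕ => (A.transpose ^ n).mulVec u) atTop (𝓝 0) := by
  refine tendsto_pi_nhds.2 fun i => ?_
  have : ∀ n : ℕ, (A.transpose ^ n).mulVec u i = ∑ j, (A ^ n) j i * u j := by
    intro n
    rw [← Matrix.transpose_pow]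
    rfl
  simp_rw [this]
  simpa using tendsto_finsetSum _ fun j (_ : j ∈ Finset.univ) =>
    (hA.tendsto_pow_apply j i).mul_const (u j)

end MatrixPowers

/-- The point `e^{iθ}` has modulus one, so it lies outside the spectrum. This makes the inverse in
the spectral density a genuine one. -/
lemma IsStableMatrix.isUnit_one_sub {p : ℕ} {A : Matrix (Fin p) (Fin p) ℝ} (hA : IsStableMatrix A)
    (θ : ℝ) :
    IsUnit (1 - Complex.exp (-(θ * Complex.I)) • A.map (fun a : ℝ => (a : ℂ))) := by
  have h1 : Complex.exp (θ * Complex.I) ∉ spectrum ℂ (A.map (fun a : ℝ => (a : ℂ))) := by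
    intro h
    have := hA _ h
    rw [Complex.norm_exp_ofReal_mul_I] at this
    exact lt_irrefl _ this
  rw [spectrum.notMem_iff] at h1
  have h2 : 1 - Complex.exp (-(θ * Complex.I)) • A.map (fun a : ℝ => (a : ℂ)) =
      Complex.exp (-(θ * Complex.I)) • (algebraMap ℂ (Matrix (Fin p) (Fin p) ℂ)
        (Complex.exp (θ * Complex.I)) - A.map (fun a : ℝ => (a : ℂ))) := by
    rw [smul_sub, Algebra.algebraMap_eq_smul_one, smul_smul, ← Complex.exp_add]
    simp
  rw [h2]
  exact h1.smul (Units.mk0 _ (Complex.exp_ne_zero (-(θ * Complex.I))))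

/-! ### The one-sided filter and the stationary variance. -/

/-- The backward filter `c_0 = v_0`, `c_{k+1} = A^T c_k + v_{k+1}`. -/
noncomputable def backwardFilter {p : ℕ} (A : Matrix (Fin p) (Fin p) ℝ) (v : ℕ → Fin p → ℝ) : ℕ → Fin p → ℝ
  | 0 => v 0
  | k + 1 => A.transpose.mulVec (backwardFilter A v k) + v (k + 1)

/-- The stationary variance `∑_k u^T A^k S (A^T)^k u` of the VAR(1) process in direction `u`. -/
noncomputable def stationaryVariance {p : ℕ} (A S : Matrix (Fin p) (Fin p) ℝ) (u : Fin p → ℝ) : ℝ :=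
  ∑' k : ℕ, (A.transpose ^ k).mulVec u ⬝ᵥ S.mulVec ((A.transpose ^ k).mulVec u)

lemma dotProduct_mulVec_nonneg_real {p : ℕ} {S : Matrix (Fin p) (Fin p) ℝ} (hS : S.PosSemidef)
    (u : Fin p → ℝ) : 0 ≤ u ⬝ᵥ S.mulVec u := by
  simpa using hS.dotProduct_mulVec_nonneg u

section Filter

variable {p : ℕ} {A S : Matrix (Fin p) (Fin p) ℝ} {C : ℝ} {v : ℕ → Fin p → ℝ} {m : ℕ}

/-- Once the input has stopped, the filter evolves freely under `Aᵀ`. -/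
lemma backwardFilter_add (hv : ∀ k, m < k → v k = 0) (i : ℕ) :
    backwardFilter A v (m + i) = (A.transpose ^ i).mulVec (backwardFilter A v m) := by
  induction i with
  | zero => simp
  | succ i ih =>
    rw [← add_assoc, backwardFilter, ih, hv _ (by omega), add_zero, Matrix.mulVec_mulVec,
      ← pow_succ']

/-- A one-sided filter is periodic up to a small change of its first input, and the change
disappears as the period grows. -/
lemma sum_backwardFilter_energy_le (hA : IsStableMatrix A) (hS : S.PosSemidef)
    (hf : ∀ θ : ℝ, ((C : ℂ) • (1 : Matrix (Fin p) (Fin p) ℂ)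
      - varSpectralDensity A S θ).PosSemidef) (hv : ∀ k, m < k → v k = 0) (N : ℕ) :
    ∑ k ∈ Finset.range N, backwardFilter A v k ⬝ᵥ S.mulVec (backwardFilter A v k)
      ≤ 2 * Real.pi * C * ∑ k ∈ Finset.range (m + 1), v k ⬝ᵥ v k := by
  set c := backwardFilter A v with hc
  have hlim : Tendsto (fun i : ℕ => A.transpose.mulVec (c (m + i))) atTop (𝓝 0) := by
    have := (hA.tendsto_transpose_pow_mulVec (c m)).comp (tendsto_add_atTop_nat 1)
    refine this.congr fun i => ?_
    rw [hc, backwardFilter_add hv, Matrix.mulVec_mulVec, ← pow_succ']; rfl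
  -- With period `m + i + 1`, replacing `v 0` by `v 0 - Aᵀ c_{m+i}` cancels the wrap-around, so `c`
  -- itself solves the periodic recursion. By `hlim` the correction tends to zero.
  have hbound : ∀ i ≥ N, ∑ k ∈ Finset.range N, c k ⬝ᵥ S.mulVec (c k) ≤ 2 * Real.pi * C *
      ((∑ k ∈ Finset.range m, v (k + 1) ⬝ᵥ v (k + 1)) + (v 0 - A.transpose.mulVec (c (m + i))) ⬝ᵥ
        (v 0 - A.transpose.mulVec (c (m + i)))) := by
    intro i hi
    have h1 := periodic_filter_energy_le hA.isUnit_one_sub hf (m + i) c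
      (fun k => if k = 0 then v 0 - A.transpose.mulVec (c (m + i)) else v k)
      (by simp [hc, backwardFilter]) (fun k _ => by simp [hc, backwardFilter])
    rw [Finset.sum_range_succ' (fun k => (if k = 0 then _ else v k) ⬝ᵥ _)] at h1
    have h2 : ∑ k ∈ Finset.range (m + i), v (k + 1) ⬝ᵥ v (k + 1)
        = ∑ k ∈ Finset.range m, v (k + 1) ⬝ᵥ v (k + 1) := by
      symm
      apply Finset.sum_subset (Finset.range_mono (by omega))
      intro k _ hk
      rw [hv _ (by simp at hk; omega)]; simp
    simp only [Nat.add_eq_zero_iff, one_ne_zero, and_false, if_false, if_true] at h1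
    rw [h2] at h1
    refine le_trans ?_ h1
    exact Finset.sum_le_sum_of_subset_of_nonneg (Finset.range_mono (by omega))
      fun k _ _ => dotProduct_mulVec_nonneg_real hS _
  have hcont : Continuous fun w : Fin p → ℝ => 2 * Real.pi * C *
      ((∑ k ∈ Finset.range m, v (k + 1) ⬝ᵥ v (k + 1)) + (v 0 - w) ⬝ᵥ (v 0 - w)) := by
    simp only [dotProduct, Pi.sub_apply]; fun_prop
  have ht := (hcont.tendsto 0).comp hlim
  rw [Finset.sum_range_succ']
  simp only [sub_zero] at ht
  refine ge_of_tendsto ht ?_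
  filter_upwards [eventually_ge_atTop N] with i hi using hbound i hi

lemma summable_impulse_energy (hA : IsStableMatrix A) (hS : S.PosSemidef)
    (hf : ∀ θ : ℝ, ((C : ℂ) • (1 : Matrix (Fin p) (Fin p) ℂ)
      - varSpectralDensity A S θ).PosSemidef) (u : Fin p → ℝ) :
    Summable fun k : ℕ => (A.transpose ^ k).mulVec u ⬝ᵥ S.mulVec ((A.transpose ^ k).mulVec u) := by
  refine summable_of_sum_range_le (c := 2 * Real.pi * C * (u ⬝ᵥ u))
    (fun k => dotProduct_mulVec_nonneg_real hS _) fun N => ?_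
  have hv : ∀ k, 0 < k → (fun k => if k = 0 then u else 0 : ℕ → Fin p → ℝ) k = 0 :=
    fun k hk => if_neg hk.ne'
  have := sum_backwardFilter_energy_le hA hS hf hv N
  refine le_of_eq_of_le (Finset.sum_congr rfl fun k _ => ?_) (le_of_le_of_eq this (by simp))
  have h1 := backwardFilter_add (A := A) hv k
  simp only [zero_add] at h1
  rw [h1]
  simp [backwardFilter]

/-- After time `m` the output is `(Aᵀ)^i c_m`, whose energy sums to the stationary variance in
direction `c_m`; the left side is therefore the total output energy. It is also the variance of a
linear functional of the observations. -/
lemma stationaryVariance_add_energy_le (hA : IsStableMatrix A) (hS : S.PosSemidef)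
    (hf : ∀ θ : ℝ, ((C : ℂ) • (1 : Matrix (Fin p) (Fin p) ℂ)
      - varSpectralDensity A S θ).PosSemidef) (hv : ∀ k, m < k → v k = 0) :
    stationaryVariance A S (backwardFilter A v m)
        + ∑ k ∈ Finset.range m, backwardFilter A v k ⬝ᵥ S.mulVec (backwardFilter A v k)
      ≤ 2 * Real.pi * C * ∑ k ∈ Finset.range (m + 1), v k ⬝ᵥ v k := by
  have ht := (summable_impulse_energy hA hS hf (backwardFilter A v m)).hasSum.tendsto_sum_nat
  refine le_of_tendsto (ht.add_const _) (Eventually.of_forall fun i => ?_)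
  have := sum_backwardFilter_energy_le hA hS hf hv (m + i)
  rw [Finset.sum_range_add] at this
  simp_rw [backwardFilter_add hv] at this
  linarith

lemma stationaryVariance_nonneg (hS : S.PosSemidef) (u : Fin p → ℝ) :
    0 ≤ stationaryVariance A S u :=
  tsum_nonneg fun _ => dotProduct_mulVec_nonneg_real hS _

/-- The term `k = 0` of a nonnegative series; this carries the lower eigenvalue bound from the noise
to `Σ`. -/
lemma le_stationaryVariance (hA : IsStableMatrix A) (hS : S.PosSemidef)
    (hf : ∀ θ : ℝ, ((C : ℂ) • (1 : Matrix (Fin p) (Fin p) ℂ)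
      - varSpectralDensity A S θ).PosSemidef) (u : Fin p → ℝ) :
    u ⬝ᵥ S.mulVec u ≤ stationaryVariance A S u := by
  have := (summable_impulse_energy hA hS hf u).sum_le_tsum {0}
    fun _ _ => dotProduct_mulVec_nonneg_real hS _
  rwa [Finset.sum_singleton, pow_zero, Matrix.one_mulVec] at this

end Filter

/-! ### Gaussian laws of linear functionals of the process. -/

lemma measurable_dotProduct_ofLp {p : ℕ} (u : Fin p → ℝ) :
    Measurable fun x : EuclideanSpace ℝ (Fin p) => u ⬝ᵥ x.ofLp := by
  simp only [dotProduct]; fun_prop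

lemma map_dotProduct_multivariateGaussian {p : ℕ} {S : Matrix (Fin p) (Fin p) ℝ}
    (hS : S.PosSemidef) (u : Fin p → ℝ) :
    (multivariateGaussian 0 S).map (fun x => u ⬝ᵥ x.ofLp)
      = gaussianReal 0 (u ⬝ᵥ S.mulVec u).toNNReal := by
  have : IsProbabilityMeasure ((multivariateGaussian 0 S).map (fun x => u ⬝ᵥ x.ofLp)) :=
    Measure.isProbabilityMeasure_map (measurable_dotProduct_ofLp u).aemeasurable
  refine Measure.ext_of_charFun (funext fun t => ?_)
  rw [charFun_apply_real, integral_map (measurable_dotProduct_ofLp u).aemeasurable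
    (by fun_prop), charFun_gaussianReal]
  have h := charFun_multivariateGaussian (μ := 0) hS (WithLp.toLp 2 (t • u))
  rw [charFun_apply] at h
  have hi : ∀ x : EuclideanSpace ℝ (Fin p),
      ((inner ℝ x (WithLp.toLp 2 (t • u)) : ℝ) : ℂ) = (t : ℂ) * ((u ⬝ᵥ x.ofLp : ℝ) : ℂ) := by
    intro x
    rw [← Complex.ofReal_mul]; congr 1
    simp only [PiLp.inner_apply, dotProduct, Finset.mul_sum]
    refine Finset.sum_congr rfl fun i _ => ?_
    simp; ring
  simp_rw [hi] at h
  rw [h, Real.coe_toNNReal _ (dotProduct_mulVec_nonneg_real hS u)]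
  simp only [inner_zero_right, Matrix.mulVec_smul, dotProduct_smul, smul_dotProduct, smul_eq_mul]
  congr 1
  push_cast; ring

namespace IsStationaryGaussianVAR

variable {Ω : Type*} [MeasurableSpace Ω] {P : Measure Ω} {p : ℕ}
  {A S : Matrix (Fin p) (Fin p) ℝ} {y e : ℕ → Ω → EuclideanSpace ℝ (Fin p)} {C : ℝ}

lemma dotProduct_recursion (h : IsStationaryGaussianVAR P A S y e) (u : Fin p → ℝ) (t : ℕ) :
    ∀ᵐ ω ∂P, u ⬝ᵥ (y (t + 1) ω).ofLp
      = A.transpose.mulVec u ⬝ᵥ (y t ω).ofLp + u ⬝ᵥ (e (t + 1) ω).ofLp := by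
  filter_upwards [h.recursion t] with ω hω
  have : (y (t + 1) ω).ofLp = A.mulVec (y t ω).ofLp + (e (t + 1) ω).ofLp := funext hω
  rw [this, dotProduct_add, Matrix.mulVec_transpose, Matrix.dotProduct_mulVec]

lemma map_dotProduct_noise (h : IsStationaryGaussianVAR P A S y e) (u : Fin p → ℝ) (t : ℕ) :
    P.map (fun ω => u ⬝ᵥ (e (t + 1) ω).ofLp) = gaussianReal 0 (u ⬝ᵥ S.mulVec u).toNNReal := by
  rw [← map_dotProduct_multivariateGaussian h.noise_cov, ← h.noise_law t,
    Measure.map_map (measurable_dotProduct_ofLp u) (h.measurable_e _)]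
  rfl

lemma map_sum_dotProduct_noise (h : IsStationaryGaussianVAR P A S y e) (a : ℕ → Fin p → ℝ)
    (s : Finset ℕ) :
    P.map (∑ t ∈ s, fun ω => a t ⬝ᵥ (e (t + 1) ω).ofLp)
      = gaussianReal 0 (∑ t ∈ s, a t ⬝ᵥ S.mulVec (a t)).toNNReal := by
  have := h.isProb
  have hind : iIndepFun (fun t ω => a t ⬝ᵥ (e (t + 1) ω).ofLp) P :=
    h.noise_indep.comp _ fun t => measurable_dotProduct_ofLp (a t)
  induction s using Finset.induction_on with
  | empty =>
    simp only [Finset.sum_empty, Real.toNNReal_zero, gaussianReal_zero_var]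
    exact (Measure.map_const P 0).trans (by simp)
  | insert i s hi ih =>
    have hi' := (hind.indepFun_finsetSum_of_notMem
      (fun t => (measurable_dotProduct_ofLp (a t)).comp (h.measurable_e _)) hi).symm
    rw [Finset.sum_insert hi, Finset.sum_insert hi,
      gaussianReal_add_gaussianReal_of_indepFun hi' (h.map_dotProduct_noise (a i) i) ih,
      Real.toNNReal_add (dotProduct_mulVec_nonneg_real h.noise_cov _)
        (Finset.sum_nonneg fun _ _ => dotProduct_mulVec_nonneg_real h.noise_cov _), add_zero]

lemma indepFun_initial_sum_noise (h : IsStationaryGaussianVAR P A S y e) (u : Fin p → ℝ)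
    (a : ℕ → Fin p → ℝ) (s : Finset ℕ) :
    IndepFun (fun ω => u ⬝ᵥ (y 0 ω).ofLp) (∑ t ∈ s, fun ω => a t ⬝ᵥ (e (t + 1) ω).ofLp) P := by
  have hm : Measurable fun g : ℕ → EuclideanSpace ℝ (Fin p) => ∑ t ∈ s, a t ⬝ᵥ (g t).ofLp :=
    Finset.measurable_sum _ fun t _ => (measurable_dotProduct_ofLp (a t)).comp (measurable_pi_apply t)
  have := h.initial_indep.comp (measurable_dotProduct_ofLp u) hm
  have hsum : (∑ t ∈ s, fun ω => a t ⬝ᵥ (e (t + 1) ω).ofLp)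
      = (fun g : ℕ → EuclideanSpace ℝ (Fin p) => ∑ t ∈ s, a t ⬝ᵥ (g t).ofLp)
        ∘ fun ω t => e (t + 1) ω := by
    funext ω
    simp
  rw [hsum]
  exact this

/-- Unrolling the recursion backwards in time. -/
lemma sum_dotProduct_eq (h : IsStationaryGaussianVAR P A S y e) (v : ℕ → Fin p → ℝ) (m : ℕ) :
    ∀ᵐ ω ∂P, ∑ k ∈ Finset.range (m + 1), v k ⬝ᵥ (y (m - k) ω).ofLp
      = backwardFilter A v m ⬝ᵥ (y 0 ω).ofLp
        + ∑ t ∈ Finset.range m, backwardFilter A v (m - 1 - t) ⬝ᵥ (e (t + 1) ω).ofLp := by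
  have hall : ∀ᵐ ω ∂P, ∀ k : ℕ, backwardFilter A v k ⬝ᵥ (y (m - k - 1 + 1) ω).ofLp
      = A.transpose.mulVec (backwardFilter A v k) ⬝ᵥ (y (m - k - 1) ω).ofLp
        + backwardFilter A v k ⬝ᵥ (e (m - k - 1 + 1) ω).ofLp :=
    ae_all_iff.2 fun k => h.dotProduct_recursion _ _
  filter_upwards [hall] with ω hω
  have hj : ∀ j ≤ m, ∑ k ∈ Finset.range (j + 1), v k ⬝ᵥ (y (m - k) ω).ofLp
      = backwardFilter A v j ⬝ᵥ (y (m - j) ω).ofLp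
        + ∑ k ∈ Finset.range j, backwardFilter A v k ⬝ᵥ (e (m - k) ω).ofLp := by
    intro j
    induction j with
    | zero => intro _; simp [backwardFilter]
    | succ j ih =>
      intro hj
      have h1 := hω j
      rw [show m - j - 1 + 1 = m - j by omega] at h1
      rw [Finset.sum_range_succ, ih (by omega), h1,
        Finset.sum_range_succ (fun k => backwardFilter A v k ⬝ᵥ (e (m - k) ω).ofLp),
        backwardFilter, add_dotProduct, show m - (j + 1) = m - j - 1 by omega]
      ring
  rw [hj m le_rfl, Nat.sub_self, ← Finset.sum_range_reflect]
  congr 1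
  refine Finset.sum_congr rfl fun k hk => ?_
  have := Finset.mem_range.1 hk
  rw [show m - (m - 1 - k) = k + 1 by omega]

/-- Stationarity permits replacing `y 0` by `y 1`, and one step of the recursion then moves the
direction `w` to `Aᵀ w` and splits off an independent Gaussian factor. The Gaussianity of `y 0` is
not assumed: it follows on letting `k → ∞`. -/
lemma charFun_map_dotProduct_initial (h : IsStationaryGaussianVAR P A S y e) (u : Fin p → ℝ)
    (k : ℕ) (t : ℝ) :
    charFun (P.map fun ω => u ⬝ᵥ (y 0 ω).ofLp) t
      = charFun (P.map fun ω => (A.transpose ^ k).mulVec u ⬝ᵥ (y 0 ω).ofLp) t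
        * Complex.exp (-((∑ i ∈ Finset.range k, (A.transpose ^ i).mulVec u ⬝ᵥ
          S.mulVec ((A.transpose ^ i).mulVec u) : ℝ) : ℂ) * t ^ 2 / 2) := by
  have := h.isProb
  induction k with
  | zero => simp
  | succ k ih =>
    set w := (A.transpose ^ k).mulVec u
    have h1 : P.map (fun ω => w ⬝ᵥ (y 0 ω).ofLp) = P.map (fun ω => w ⬝ᵥ (y 1 ω).ofLp) :=
      ((h.stationary 1).comp (measurable_dotProduct_ofLp w)).map_eq.symm
    have h2 : P.map (fun ω => w ⬝ᵥ (y 1 ω).ofLp) = P.map ((fun ω => A.transpose.mulVec w ⬝ᵥ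
        (y 0 ω).ofLp) + fun ω => w ⬝ᵥ (e (0 + 1) ω).ofLp) :=
      Measure.map_congr (h.dotProduct_recursion w 0)
    have h3 := h.indepFun_initial_sum_noise (A.transpose.mulVec w) (fun _ => w) {0}
    rw [Finset.sum_singleton] at h3
    have hm1 : Measurable fun ω => A.transpose.mulVec w ⬝ᵥ (y 0 ω).ofLp :=
      (measurable_dotProduct_ofLp _).comp (h.measurable_y 0)
    have hm2 : Measurable fun ω => w ⬝ᵥ (e (0 + 1) ω).ofLp :=
      (measurable_dotProduct_ofLp _).comp (h.measurable_e _)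
    rw [ih, h1, h2, h3.charFun_map_add_eq_mul hm1.aemeasurable hm2.aemeasurable, Pi.mul_apply,
      h.map_dotProduct_noise, charFun_gaussianReal,
      Real.coe_toNNReal _ (dotProduct_mulVec_nonneg_real h.noise_cov w), mul_assoc,
      ← Complex.exp_add, Finset.sum_range_succ, Matrix.mulVec_mulVec, ← pow_succ']
    congr 2
    push_cast; ring

/-- The initial vector of a stationary Gaussian VAR(1) process is Gaussian. -/
lemma map_dotProduct_initial (h : IsStationaryGaussianVAR P A S y e)
    (hf : ∀ θ : ℝ, ((C : ℂ) • (1 : Matrix (Fin p) (Fin p) ℂ)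
      - varSpectralDensity A S θ).PosSemidef) (u : Fin p → ℝ) :
    P.map (fun ω => u ⬝ᵥ (y 0 ω).ofLp) = gaussianReal 0 (stationaryVariance A S u).toNNReal := by
  have := h.isProb
  have hm : ∀ w : Fin p → ℝ, Measurable fun ω => w ⬝ᵥ (y 0 ω).ofLp :=
    fun w => (measurable_dotProduct_ofLp w).comp (h.measurable_y 0)
  have : IsProbabilityMeasure (P.map (fun ω => u ⬝ᵥ (y 0 ω).ofLp)) :=
    Measure.isProbabilityMeasure_map (hm u).aemeasurable
  refine Measure.ext_of_charFun (funext fun t => ?_)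
  have h1 : Tendsto (fun k : ℕ => charFun
      (P.map fun ω => (A.transpose ^ k).mulVec u ⬝ᵥ (y 0 ω).ofLp) t) atTop (𝓝 1) := by
    have : ∀ w : Fin p → ℝ, charFun (P.map fun ω => w ⬝ᵥ (y 0 ω).ofLp) t
        = ∫ ω, Complex.exp (t * ((w ⬝ᵥ (y 0 ω).ofLp : ℝ) : ℂ) * Complex.I) ∂P := by
      intro w
      rw [charFun_apply_real, integral_map (hm w).aemeasurable (by fun_prop)]
    simp_rw [this]
    have h1 : (1 : ℂ) = ∫ ω, (1 : ℂ) ∂P := by simp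
    rw [h1]
    refine tendsto_integral_of_dominated_convergence (fun _ => 1) (fun k => ?_) (by simp)
      (fun k => Eventually.of_forall fun ω => ?_) (Eventually.of_forall fun ω => ?_)
    · have := hm ((A.transpose ^ k).mulVec u)
      exact Measurable.aestronglyMeasurable (by fun_prop)
    · rw [← Complex.ofReal_mul, Complex.norm_exp_ofReal_mul_I]
    · have hc : Continuous fun w : Fin p → ℝ =>
          Complex.exp (t * ((w ⬝ᵥ (y 0 ω).ofLp : ℝ) : ℂ) * Complex.I) := by
        simp only [dotProduct]; fun_prop
      simpa [Function.comp_def] using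
        (hc.tendsto 0).comp (h.stable.tendsto_transpose_pow_mulVec u)
  have h2 := (summable_impulse_energy h.stable h.noise_cov hf u).hasSum.tendsto_sum_nat
  have hc : Continuous fun s : ℝ => Complex.exp (-(s : ℂ) * t ^ 2 / 2) := by fun_prop
  have h3 := h1.mul ((hc.tendsto _).comp h2)
  have h4 := tendsto_nhds_unique
    (tendsto_const_nhds.congr fun k => h.charFun_map_dotProduct_initial u k t) h3
  rw [h4, one_mul, charFun_gaussianReal,
    Real.coe_toNNReal _ (stationaryVariance_nonneg h.noise_cov u)]
  congr 1
  simp only [stationaryVariance]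
  push_cast; ring

/-- Linear functionals of `m + 1` consecutive observations are Gaussian, with variance controlled
by the spectral density. -/
lemma map_sum_dotProduct (h : IsStationaryGaussianVAR P A S y e)
    (hf : ∀ θ : ℝ, ((C : ℂ) • (1 : Matrix (Fin p) (Fin p) ℂ)
      - varSpectralDensity A S θ).PosSemidef) (w : ℕ → Fin p → ℝ) (n : ℕ) :
    ∃ s : NNReal, P.map (fun ω => ∑ t ∈ Finset.range n, w t ⬝ᵥ (y t ω).ofLp) = gaussianReal 0 s ∧
      (s : ℝ) ≤ 2 * Real.pi * C * ∑ t ∈ Finset.range n, w t ⬝ᵥ w t := by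
  have := h.isProb
  cases n with
  | zero => exact ⟨0, by simp [Measure.map_const, gaussianReal_zero_var], by simp⟩
  | succ m =>
    -- The weights are reversed in time because the filter runs from the last observation back to `y
    -- 0`.
    set v : ℕ → Fin p → ℝ := fun k => if k ≤ m then w (m - k) else 0 with hv
    have hv0 : ∀ k, m < k → v k = 0 := fun k hk => if_neg (by omega)
    have hvw : ∀ k ∈ Finset.range (m + 1), v k = w (m - k) := fun k hk =>
      if_pos (by have := Finset.mem_range.1 hk; omega)
    set c := backwardFilter A v with hc
    have hnn : 0 ≤ ∑ t ∈ Finset.range m, c (m - 1 - t) ⬝ᵥ S.mulVec (c (m - 1 - t)) :=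
      Finset.sum_nonneg fun _ _ => dotProduct_mulVec_nonneg_real h.noise_cov _
    refine ⟨(stationaryVariance A S (c m)).toNNReal +
      (∑ t ∈ Finset.range m, c (m - 1 - t) ⬝ᵥ S.mulVec (c (m - 1 - t))).toNNReal, ?_, ?_⟩
    · rw [← add_zero (0 : ℝ), ← gaussianReal_add_gaussianReal_of_indepFun
        (h.indepFun_initial_sum_noise (c m) (fun t => c (m - 1 - t)) (Finset.range m))
        (h.map_dotProduct_initial hf _) (h.map_sum_dotProduct_noise _ _)]
      refine Measure.map_congr ?_
      filter_upwards [h.sum_dotProduct_eq v m] with ω hω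
      rw [← Finset.sum_range_reflect]
      simp only [Pi.add_apply, Finset.sum_apply]
      rw [← hω]
      refine Finset.sum_congr rfl fun k hk => ?_
      rw [hvw k hk, show m + 1 - 1 - k = m - k by omega]
    · have h1 := stationaryVariance_add_energy_le h.stable h.noise_cov hf hv0
      rw [NNReal.coe_add, Real.coe_toNNReal _ (stationaryVariance_nonneg h.noise_cov _),
        Real.coe_toNNReal _ hnn, Finset.sum_range_reflect (fun t => c t ⬝ᵥ S.mulVec (c t))]
      refine h1.trans (le_of_eq ?_)
      rw [← Finset.sum_range_reflect (fun t => w t ⬝ᵥ w t)]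
      congr 1
      refine Finset.sum_congr rfl fun k hk => ?_
      rw [hvw k hk, show m + 1 - 1 - k = m - k by omega]

end IsStationaryGaussianVAR

/-! ### Concentration of the squared norm of a Gaussian vector. -/

/-- The left side is the moment generating function of a centred chi-square variable, up to scaling;
squaring reduces the bound to `1 ≤ e^{x + x²} (1 - x)`. -/
lemma exp_neg_mul_inv_sqrt_le {x : ℝ} (hx : |x| ≤ 1 / 2) :
    Real.exp (-(x / 2)) * (√(1 - x))⁻¹ ≤ Real.exp (x ^ 2 / 2) := by
  obtain ⟨h1, h2⟩ := abs_le.1 hx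
  have hpos : 0 < 1 - x := by linarith
  -- For `x ≤ 0` the bound `1 + y ≤ e^y` suffices; for `x ≥ 0` its quadratic refinement is needed.
  have key : 1 ≤ Real.exp (x + x ^ 2) * (1 - x) := by
    rcases le_total x 0 with h0 | h0
    · have := Real.add_one_le_exp (x + x ^ 2)
      have h3 : (x + x ^ 2 + 1) * (1 - x) ≤ Real.exp (x + x ^ 2) * (1 - x) :=
        mul_le_mul_of_nonneg_right this hpos.le
      nlinarith [mul_nonneg (neg_nonneg.2 h0) (sq_nonneg x)]
    · have hy : 0 ≤ x + x ^ 2 := by positivity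
      have := Real.quadratic_le_exp_of_nonneg hy
      have h3 := mul_le_mul_of_nonneg_right this hpos.le
      refine le_trans ?_ h3
      nlinarith [mul_nonneg h0 h0, mul_nonneg (mul_nonneg h0 h0) (sub_nonneg.2 h2),
        mul_nonneg (mul_nonneg (mul_nonneg h0 h0) h0) (sub_nonneg.2 h2)]
  have hs : 0 < √(1 - x) := Real.sqrt_pos.2 hpos
  have hsq : 1 ≤ Real.exp ((x + x ^ 2) / 2) * √(1 - x) := by
    have h4 : (Real.exp ((x + x ^ 2) / 2) * √(1 - x)) ^ 2 = Real.exp (x + x ^ 2) * (1 - x) := by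
      rw [mul_pow, Real.sq_sqrt hpos.le, ← Real.exp_nat_mul]; congr 2; push_cast; ring
    refine (one_le_sq_iff₀ (by positivity)).1 ?_
    rw [h4]; exact key
  rw [← div_eq_mul_inv, div_le_iff₀ hs]
  calc Real.exp (-(x / 2)) = Real.exp (-(x / 2)) * 1 := by ring
    _ ≤ Real.exp (-(x / 2)) * (Real.exp ((x + x ^ 2) / 2) * √(1 - x)) := by gcongr
    _ = Real.exp (x ^ 2 / 2) * √(1 - x) := by
      rw [← mul_assoc, ← Real.exp_add]; congr 2; ring

lemma integral_exp_mul_sq_gaussianReal {v : NNReal} {s : ℝ} (hs : 2 * s * v < 1) :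
    ∫ x, Real.exp (s * x ^ 2) ∂(gaussianReal 0 v) = (√(1 - 2 * s * v))⁻¹ := by
  rcases eq_or_ne v 0 with rfl | hv
  · simp [gaussianReal_zero_var]
  have hv' : (0 : ℝ) < v := by positivity
  rw [integral_gaussianReal_eq_integral_smul hv]
  have h1 : ∀ x : ℝ, gaussianPDFReal 0 v x • Real.exp (s * x ^ 2)
      = (√(2 * Real.pi * v))⁻¹ * Real.exp (-(1 / (2 * v) - s) * x ^ 2) := by
    intro x
    rw [gaussianPDFReal, smul_eq_mul, mul_assoc, ← Real.exp_add]
    congr 2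
    field_simp
    ring
  simp_rw [h1]
  rw [integral_const_mul, integral_gaussian, ← Real.sqrt_inv, ← Real.sqrt_mul (by positivity),
    ← Real.sqrt_inv]
  congr 1
  have h2 : (1 : ℝ) / (2 * v) - s = (1 - 2 * s * v) / (2 * v) := by field_simp
  have h3 : 1 - 2 * s * (v : ℝ) ≠ 0 := by linarith
  have := Real.pi_pos
  rw [h2]
  field_simp

section

variable {Ω : Type*} [MeasurableSpace Ω] {P : Measure Ω}

lemma mgf_sq_sub_le {Y : Ω → ℝ} {v : NNReal} (hY : P.map Y = gaussianReal 0 v)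
    (hm : Measurable Y) {s : ℝ} (hs : |s| * v ≤ 1 / 4) :
    mgf (fun ω => Y ω ^ 2 - v) P s ≤ Real.exp (2 * s ^ 2 * v ^ 2) ∧
      Integrable (fun ω => Real.exp (s * (Y ω ^ 2 - v))) P := by
  have hx : |2 * s * v| ≤ 1 / 2 := by
    rw [abs_mul, abs_mul, NNReal.abs_eq]; norm_num; linarith
  have hlt : 2 * s * v < 1 := by linarith [le_abs_self (2 * s * v)]
  have hi : ∫ ω, Real.exp (s * (Y ω ^ 2 - v)) ∂P
      = Real.exp (-(2 * s * v / 2)) * (√(1 - 2 * s * v))⁻¹ := by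
    rw [← integral_exp_mul_sq_gaussianReal hlt, ← hY, integral_map hm.aemeasurable (by fun_prop),
      ← integral_const_mul]
    congr 1; ext ω
    rw [← Real.exp_add]; congr 1; ring
  have hpos : 0 < √(1 - 2 * s * v) := Real.sqrt_pos.2 (by linarith)
  refine ⟨?_, ?_⟩
  · rw [mgf, hi]
    refine (exp_neg_mul_inv_sqrt_le hx).trans (le_of_eq ?_)
    congr 1; ring
  -- A non-integrable function has integral `0` by convention, whereas this integral is positive.
  · refine not_imp_comm.1 integral_undef ?_
    rw [hi]; positivity

lemma integral_sq_eq_of_map_eq {Y : Ω → ℝ} {v : NNReal} (hY : P.map Y = gaussianReal 0 v)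
    (hm : Measurable Y) : ∫ ω, Y ω ^ 2 ∂P = v := by
  have h := variance_fun_id_gaussianReal (μ := 0) (v := v)
  rw [variance_eq_integral (by fun_prop)] at h
  simp only [integral_id_gaussianReal, sub_zero] at h
  rw [← h, ← hY, integral_map hm.aemeasurable (by fun_prop)]

lemma memLp_two_of_map_eq {Y : Ω → ℝ} {v : NNReal} (hY : P.map Y = gaussianReal 0 v)
    (hm : Measurable Y) : MemLp Y 2 P := by
  have h : MemLp id 2 (P.map Y) := by rw [hY]; exact memLp_id_gaussianReal' 2 (by simp)
  exact (memLp_map_measure_iff (by fun_prop) hm.aemeasurable).1 h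

variable {n : ℕ} {x : Fin n → Ω → ℝ} {B : ℝ}

/-- Cramér–Wold: every linear functional on `Fin n → ℝ` is one of these weighted sums. -/
lemma hasGaussianLaw_of_forall_sum (hm : ∀ t, Measurable (x t))
    (hx : ∀ a : Fin n → ℝ, ∃ s : NNReal, P.map (fun ω => ∑ t, a t * x t ω) = gaussianReal 0 s) :
    HasGaussianLaw (fun ω t => x t ω) P := by
  refine ⟨isGaussian_of_map_eq_gaussianReal fun L => ?_⟩
  obtain ⟨s, hs⟩ := hx fun t => L (Pi.single t 1)
  refine ⟨0, s, ?_⟩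
  rw [Measure.map_map (by fun_prop) (measurable_pi_lambda _ hm), ← hs]
  congr 1
  ext ω
  simp only [Function.comp_apply]
  conv_lhs => rw [← Finset.univ_sum_single (fun t => x t ω)]
  rw [map_sum]
  refine Finset.sum_congr rfl fun t _ => ?_
  have : (Pi.single t (x t ω) : Fin n → ℝ) = x t ω • Pi.single t 1 := by
    rw [← Pi.single_smul]; simp
  rw [this, map_smul, smul_eq_mul, mul_comm]

/-- A centred Gaussian vector whose covariance is at most `B` can be rotated to independent
coordinates. -/
lemma exists_independent_rotation (hm : ∀ t, Measurable (x t))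
    (hx : ∀ a : Fin n → ℝ, ∃ s : NNReal, P.map (fun ω => ∑ t, a t * x t ω) = gaussianReal 0 s ∧
      (s : ℝ) ≤ B * ∑ t, a t ^ 2) :
    ∃ (Y : Fin n → Ω → ℝ) (v : Fin n → NNReal), (∀ i, Measurable (Y i)) ∧ iIndepFun Y P ∧
      (∀ i, P.map (Y i) = gaussianReal 0 (v i)) ∧ (∀ i, (v i : ℝ) ≤ B) ∧
      ∀ ω, ∑ i, Y i ω ^ 2 = ∑ t, x t ω ^ 2 := by
  have hgx := hasGaussianLaw_of_forall_sum hm fun a => (hx a).imp fun _ h => h.1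
  have hL : ∀ t, MemLp (x t) 2 P := fun t => (hgx.eval t).memLp_two
  have hP := hgx.isProbabilityMeasure
  set Γ : Matrix (Fin n) (Fin n) ℝ := Matrix.of fun s t => cov[x s, x t; P] with hΓd
  have hΓ : Γ.IsHermitian := by
    ext s t
    simp [hΓd, covariance_comm]
  set b := hΓ.eigenvectorBasis with hb
  set Y : Fin n → Ω → ℝ := fun i ω => ∑ t, b i t * x t ω with hYd
  have hYm : ∀ i, Measurable (Y i) := fun i =>
    Finset.measurable_sum _ fun t _ => (hm t).const_mul _
  have hnorm : ∀ i, ∑ t, b i t ^ 2 = 1 := by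
    intro i
    have := b.orthonormal.1 i
    rw [← EuclideanSpace.real_norm_sq_eq, this]; norm_num
  choose v hv hvB using fun i => hx fun t => b i t
  have hgY : HasGaussianLaw (fun ω i => Y i ω) P := by
    refine hasGaussianLaw_of_forall_sum hYm fun a => ?_
    obtain ⟨s, hs, -⟩ := hx fun t => ∑ i, a i * b i t
    refine ⟨s, ?_⟩
    rw [← hs]
    congr 1; ext ω
    simp only [hYd, Finset.mul_sum, Finset.sum_mul]
    rw [Finset.sum_comm]
    refine Finset.sum_congr rfl fun t _ => Finset.sum_congr rfl fun i _ => by ring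
  refine ⟨Y, v, hYm, ?_, hv, fun i => by simpa [hnorm] using hvB i, fun ω => ?_⟩
  -- The coordinates in an eigenbasis of the covariance matrix are uncorrelated, and joint
  -- Gaussianity upgrades this to independence.
  · refine hgY.iIndepFun_of_covariance_eq_zero fun i j hij => ?_
    have h1 : cov[Y i, Y j; P] = ∑ s, ∑ t, b i s * (b j t * cov[x s, x t; P]) := by
      rw [hYd, covariance_fun_sum_fun_sum (fun s => (hL s).const_mul _)
        (fun t => (hL t).const_mul _)]
      refine Finset.sum_congr rfl fun s _ => Finset.sum_congr rfl fun t _ => ?_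
      rw [covariance_const_mul_left, covariance_const_mul_right]
    have h2 := congrArg (fun w => (b i).ofLp ⬝ᵥ w) (hΓ.mulVec_eigenvectorBasis j)
    simp only [dotProduct_smul] at h2
    have h3 : (b i).ofLp ⬝ᵥ (b j).ofLp = 0 := by
      have := b.orthonormal.2 hij
      simpa [PiLp.inner_apply, dotProduct, mul_comm] using this
    rw [← hb, h3, smul_zero] at h2
    rw [h1, ← h2]
    simp only [dotProduct, Matrix.mulVec, Finset.mul_sum, hΓd, Matrix.of_apply]
    refine Finset.sum_congr rfl fun s _ => Finset.sum_congr rfl fun t _ => by ring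
  · have h := b.sum_sq_inner_right (WithLp.toLp 2 fun t => x t ω)
    rw [EuclideanSpace.real_norm_sq_eq] at h
    rw [← h]
    refine Finset.sum_congr rfl fun i _ => ?_
    congr 1
    simp only [hYd, PiLp.inner_apply]
    refine Finset.sum_congr rfl fun t _ => ?_
    simp [mul_comm]

/-- Exponential concentration of the squared norm of a Gaussian vector with covariance at most
`B`. -/
lemma measure_abs_sum_sq_sub_ge_le (hB : 0 < B) (hm : ∀ t, Measurable (x t))
    (hx : ∀ a : Fin n → ℝ, ∃ s : NNReal, P.map (fun ω => ∑ t, a t * x t ω) = gaussianReal 0 s ∧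
      (s : ℝ) ≤ B * ∑ t, a t ^ 2) {τ ε : ℝ} (hτ0 : 0 ≤ τ) (hτ : τ ≤ 1) :
    P.real {ω | n * ε ≤ |∑ t, x t ω ^ 2 - ∫ ω, ∑ t, x t ω ^ 2 ∂P|}
      ≤ 2 * Real.exp (-(n * (τ * ε / (4 * B) - τ ^ 2 / 8))) := by
  obtain ⟨Y, v, hYm, hind, hY, hvB, hsum⟩ := exists_independent_rotation hm hx
  have hP := hind.isProbabilityMeasure
  set Z : Fin n → Ω → ℝ := fun i ω => Y i ω ^ 2 - v i with hZ
  have hZind : iIndepFun Z P := hind.comp (fun i y => y ^ 2 - v i) fun i => by fun_prop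
  have hZm : ∀ i, Measurable (Z i) := fun i => ((hYm i).pow_const 2).sub_const _
  have hmean : ∫ ω, ∑ t, x t ω ^ 2 ∂P = ∑ i, (v i : ℝ) := by
    simp_rw [← hsum]
    rw [integral_finsetSum _ fun i _ => (memLp_two_of_map_eq (hY i) (hYm i)).integrable_sq]
    exact Finset.sum_congr rfl fun i _ => integral_sq_eq_of_map_eq (hY i) (hYm i)
  have hZsum : ∀ ω, ∑ t, x t ω ^ 2 - ∫ ω, ∑ t, x t ω ^ 2 ∂P = (∑ i, Z i) ω := by
    intro ω
    rw [hmean, ← hsum, Finset.sum_apply, ← Finset.sum_sub_distrib]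
  have hmgf : ∀ s : ℝ, |s| * B ≤ 1 / 4 → mgf (∑ i, Z i) P s ≤ Real.exp (n * (2 * s ^ 2 * B ^ 2)) ∧
      Integrable (fun ω => Real.exp (s * (∑ i, Z i) ω)) P := by
    intro s hs
    have hsv : ∀ i, |s| * v i ≤ 1 / 4 := fun i =>
      (mul_le_mul_of_nonneg_left (hvB i) (abs_nonneg s)).trans hs
    refine ⟨?_, hZind.integrable_exp_mul_sum hZm
      fun i _ => (mgf_sq_sub_le (hY i) (hYm i) (hsv i)).2⟩
    rw [hZind.mgf_sum hZm]
    refine (Finset.prod_le_prod (fun _ _ => mgf_nonneg) fun i _ =>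
      (mgf_sq_sub_le (hY i) (hYm i) (hsv i)).1.trans
        (Real.exp_le_exp.2 (?_ : _ ≤ 2 * s ^ 2 * B ^ 2))).trans ?_
    · have := hvB i
      gcongr
    · rw [Finset.prod_const, Finset.card_univ, Fintype.card_fin, ← Real.exp_nat_mul]
  -- The Chernoff parameter; `τ ≤ 1` keeps it in the range `|s| B ≤ 1/4` where the moment generating
  -- function is controlled.
  set s := τ / (4 * B) with hsd
  have hs0 : 0 ≤ s := by positivity
  have hsB : |s| * B ≤ 1 / 4 := by
    rw [abs_of_nonneg hs0, hsd]
    have : τ / (4 * B) * B = τ / 4 := by field_simp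
    rw [this]; linarith
  have hval : n * (2 * s ^ 2 * B ^ 2) = n * (τ ^ 2 / 8) := by
    rw [hsd]; field_simp; ring
  have hup : P.real {ω | n * ε ≤ (∑ i, Z i) ω}
      ≤ Real.exp (-(n * (τ * ε / (4 * B) - τ ^ 2 / 8))) := by
    obtain ⟨h1, h2⟩ := hmgf s hsB
    refine (measure_ge_le_exp_mul_mgf (n * ε) hs0 h2).trans
      ((mul_le_mul_of_nonneg_left h1 (Real.exp_pos _).le).trans (le_of_eq ?_))
    rw [hval, ← Real.exp_add, hsd]; congr 1; ring
  have hlo : P.real {ω | (∑ i, Z i) ω ≤ -(n * ε)}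
      ≤ Real.exp (-(n * (τ * ε / (4 * B) - τ ^ 2 / 8))) := by
    obtain ⟨h1, h2⟩ := hmgf (-s) (by rwa [abs_neg])
    refine (measure_le_le_exp_mul_mgf (-(n * ε)) (neg_nonpos.2 hs0) h2).trans
      ((mul_le_mul_of_nonneg_left h1 (Real.exp_pos _).le).trans (le_of_eq ?_))
    rw [neg_sq, hval, ← Real.exp_add, hsd]; congr 1; ring
  simp_rw [hZsum]
  refine (measureReal_mono (s₂ := {ω | n * ε ≤ (∑ i, Z i) ω} ∪ {ω | (∑ i, Z i) ω ≤ -(n * ε)})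
    fun ω hω => ?_).trans ((measureReal_union_le _ _).trans (by linarith))
  have hω' : n * ε ≤ |(∑ i, Z i) ω| := hω
  rcases le_abs.1 hω' with h | h
  · exact Or.inl h
  · exact Or.inr (show (∑ i, Z i) ω ≤ -(n * ε) by linarith)

end

/-! ### Second moments and concentration for the VAR process. -/

lemma dotProduct_self_nonneg_real {p : ℕ} (u : Fin p → ℝ) : 0 ≤ u ⬝ᵥ u :=
  Finset.sum_nonneg fun i _ => mul_self_nonneg (u i)

namespace IsStationaryGaussianVAR

variable {Ω : Type*} [MeasurableSpace Ω] {P : Measure Ω} {p : ℕ}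
  {A S : Matrix (Fin p) (Fin p) ℝ} {y e : ℕ → Ω → EuclideanSpace ℝ (Fin p)} {c C : ℝ}

lemma measurable_dotProduct (h : IsStationaryGaussianVAR P A S y e) (u : Fin p → ℝ) (t : ℕ) :
    Measurable fun ω => u ⬝ᵥ (y t ω).ofLp :=
  (measurable_dotProduct_ofLp u).comp (h.measurable_y t)

lemma map_dotProduct (h : IsStationaryGaussianVAR P A S y e)
    (hf : ∀ θ : ℝ, ((C : ℂ) • (1 : Matrix (Fin p) (Fin p) ℂ)
      - varSpectralDensity A S θ).PosSemidef) (u : Fin p → ℝ) (t : ℕ) :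
    P.map (fun ω => u ⬝ᵥ (y t ω).ofLp) = gaussianReal 0 (stationaryVariance A S u).toNNReal :=
  ((h.stationary t).comp (measurable_dotProduct_ofLp u)).map_eq.trans
    (h.map_dotProduct_initial hf u)

lemma integral_dotProduct_sq (h : IsStationaryGaussianVAR P A S y e)
    (hf : ∀ θ : ℝ, ((C : ℂ) • (1 : Matrix (Fin p) (Fin p) ℂ)
      - varSpectralDensity A S θ).PosSemidef) (u : Fin p → ℝ) (t : ℕ) :
    ∫ ω, (u ⬝ᵥ (y t ω).ofLp) ^ 2 ∂P = stationaryVariance A S u := by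
  rw [integral_sq_eq_of_map_eq (h.map_dotProduct hf u t) (h.measurable_dotProduct u t),
    Real.coe_toNNReal _ (stationaryVariance_nonneg h.noise_cov u)]

lemma memLp_dotProduct (h : IsStationaryGaussianVAR P A S y e)
    (hf : ∀ θ : ℝ, ((C : ℂ) • (1 : Matrix (Fin p) (Fin p) ℂ)
      - varSpectralDensity A S θ).PosSemidef) (u : Fin p → ℝ) (t : ℕ) :
    MemLp (fun ω => u ⬝ᵥ (y t ω).ofLp) 2 P :=
  memLp_two_of_map_eq (h.map_dotProduct hf u t) (h.measurable_dotProduct u t)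

/-- Links the matrix that defines `γ_j` to the series controlled by the filter estimates. -/
lemma dotProduct_secondMoment_mulVec (h : IsStationaryGaussianVAR P A S y e)
    (hf : ∀ θ : ℝ, ((C : ℂ) • (1 : Matrix (Fin p) (Fin p) ℂ)
      - varSpectralDensity A S θ).PosSemidef) (u : Fin p → ℝ) :
    u ⬝ᵥ (secondMoment P y).mulVec u = stationaryVariance A S u := by
  have hL : ∀ i, MemLp (fun ω => y 0 ω i) 2 P := fun i => by
    simpa using h.memLp_dotProduct hf (Pi.single i 1) 0
  rw [← h.integral_dotProduct_sq hf u 0]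
  have hexp : ∀ ω, (u ⬝ᵥ (y 0 ω).ofLp) ^ 2 = ∑ i, ∑ k, u i * u k * (y 0 ω i * y 0 ω k) := by
    intro ω
    rw [sq, dotProduct, Finset.sum_mul_sum]
    refine Finset.sum_congr rfl fun i _ => Finset.sum_congr rfl fun k _ => by ring
  simp_rw [hexp]
  have hint : ∀ i k, Integrable (fun ω => u i * u k * (y 0 ω i * y 0 ω k)) P := fun i k =>
    ((hL i).integrable_mul (hL k)).const_mul _
  rw [integral_finsetSum _ fun i _ => integrable_finsetSum _ fun k _ => hint i k]
  simp only [dotProduct, Matrix.mulVec, Finset.mul_sum]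
  refine Finset.sum_congr rfl fun i _ => ?_
  rw [integral_finsetSum _ fun k _ => hint i k]
  refine Finset.sum_congr rfl fun k _ => ?_
  rw [integral_const_mul, secondMoment, Matrix.of_apply]; ring

lemma secondMoment_transpose : (secondMoment P y).transpose = secondMoment P y := by
  ext i k
  simp [secondMoment, mul_comm]

lemma exists_map_sum_mul (h : IsStationaryGaussianVAR P A S y e)
    (hf : ∀ θ : ℝ, ((C : ℂ) • (1 : Matrix (Fin p) (Fin p) ℂ)
      - varSpectralDensity A S θ).PosSemidef) (u : Fin p → ℝ) (n : ℕ) (a : Fin n → ℝ) :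
    ∃ s : NNReal, P.map (fun ω => ∑ t : Fin n, a t * (u ⬝ᵥ (y t ω).ofLp)) = gaussianReal 0 s ∧
      (s : ℝ) ≤ 2 * Real.pi * C * (u ⬝ᵥ u) * ∑ t, a t ^ 2 := by
  obtain ⟨s, hs, hs'⟩ := h.map_sum_dotProduct hf
    (fun t => if ht : t < n then a ⟨t, ht⟩ • u else 0) n
  refine ⟨s, ?_, ?_⟩
  · rw [← hs]
    congr 1; ext ω
    rw [← Fin.sum_univ_eq_sum_range]
    refine Finset.sum_congr rfl fun t _ => ?_
    simp [t.2]
  · refine hs'.trans (le_of_eq ?_)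
    rw [← Fin.sum_univ_eq_sum_range, mul_assoc _ (u ⬝ᵥ u), Finset.mul_sum (a := u ⬝ᵥ u)]
    congr 1
    refine Finset.sum_congr rfl fun t _ => ?_
    simp [t.2]; ring

lemma stationaryVariance_le (h : IsStationaryGaussianVAR P A S y e)
    (hf : ∀ θ : ℝ, ((C : ℂ) • (1 : Matrix (Fin p) (Fin p) ℂ)
      - varSpectralDensity A S θ).PosSemidef) (u : Fin p → ℝ) :
    stationaryVariance A S u ≤ 2 * Real.pi * C * (u ⬝ᵥ u) := by
  have := stationaryVariance_add_energy_le (v := fun k => if k = 0 then u else 0) (m := 0) h.stable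
    h.noise_cov hf fun k hk => if_neg hk.ne'
  simpa [backwardFilter] using this

lemma measure_quadratic_ge_le (h : IsStationaryGaussianVAR P A S y e)
    (hf : ∀ θ : ℝ, ((C : ℂ) • (1 : Matrix (Fin p) (Fin p) ℂ)
      - varSpectralDensity A S θ).PosSemidef) (u : Fin p → ℝ) (n : ℕ) {B τ ε : ℝ} (hB : 0 < B)
    (hu : 2 * Real.pi * C * (u ⬝ᵥ u) ≤ B) (hτ0 : 0 ≤ τ) (hτ : τ ≤ 1) :
    P.real {ω | n * ε ≤ |∑ t : Fin n, (u ⬝ᵥ (y t ω).ofLp) ^ 2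
        - n * (u ⬝ᵥ (secondMoment P y).mulVec u)|}
      ≤ 2 * Real.exp (-(n * (τ * ε / (4 * B) - τ ^ 2 / 8))) := by
  have hmean : ∫ ω, ∑ t : Fin n, (u ⬝ᵥ (y t ω).ofLp) ^ 2 ∂P
      = n * (u ⬝ᵥ (secondMoment P y).mulVec u) := by
    rw [integral_finsetSum _ fun (t : Fin n) _ => (h.memLp_dotProduct hf u t).integrable_sq,
      h.dotProduct_secondMoment_mulVec hf]
    simp [h.integral_dotProduct_sq hf]
  rw [← hmean]
  refine measure_abs_sum_sq_sub_ge_le hB (fun t => h.measurable_dotProduct u t) (fun a => ?_)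
    hτ0 hτ
  obtain ⟨s, hs, hs'⟩ := h.exists_map_sum_mul hf u n a
  exact ⟨s, hs, hs'.trans (mul_le_mul_of_nonneg_right hu
    (Finset.sum_nonneg fun _ _ => sq_nonneg _))⟩

/-- Polarization: the product is a quarter of the difference of the squares along `u + w` and `u -
w`. Both directions have squared norm at most `4R`, hence the constant `8πCR = 2πC · 4R`. -/
lemma measure_bilinear_ge_le (h : IsStationaryGaussianVAR P A S y e) (hC : 0 < C)
    (hf : ∀ θ : ℝ, ((C : ℂ) • (1 : Matrix (Fin p) (Fin p) ℂ)
      - varSpectralDensity A S θ).PosSemidef) (u w : Fin p → ℝ) (n : ℕ) {R τ ε : ℝ} (hR : 0 < R)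
    (hu : u ⬝ᵥ u ≤ R) (hw : w ⬝ᵥ w ≤ R) (hτ0 : 0 ≤ τ) (hτ : τ ≤ 1) :
    P.real {ω | n * ε ≤ |∑ t : Fin n, (u ⬝ᵥ (y t ω).ofLp) * (w ⬝ᵥ (y t ω).ofLp)
        - n * (u ⬝ᵥ (secondMoment P y).mulVec w)|}
      ≤ 4 * Real.exp (-(n * (τ * ε / (2 * (8 * Real.pi * C * R)) - τ ^ 2 / 8))) := by
  have := h.isProb
  set Sg := secondMoment P y with hSg
  have hB : 0 < 8 * Real.pi * C * R := by positivity
  have hsym : w ⬝ᵥ Sg.mulVec u = u ⬝ᵥ Sg.mulVec w := by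
    rw [Matrix.dotProduct_mulVec, ← Matrix.mulVec_transpose, hSg, secondMoment_transpose,
      dotProduct_comm]
  have huw : |u ⬝ᵥ w| ≤ R := by
    have h1 := dotProduct_self_nonneg_real (u + w)
    have h2 := dotProduct_self_nonneg_real (u - w)
    simp only [add_dotProduct, dotProduct_add, sub_dotProduct, dotProduct_sub,
      dotProduct_comm w u] at h1 h2
    exact abs_le.2 ⟨by linarith, by linarith⟩
  have hle : ∀ z : Fin p → ℝ, z ⬝ᵥ z ≤ 4 * R → 2 * Real.pi * C * (z ⬝ᵥ z) ≤ 8 * Real.pi * C * R := by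
    intro z hz
    have : 0 ≤ 2 * Real.pi * C := by positivity
    nlinarith [mul_le_mul_of_nonneg_left hz this]
  have h1 := h.measure_quadratic_ge_le hf (u + w) n (ε := 2 * ε) hB (hle _ (by
    simp only [add_dotProduct, dotProduct_add, dotProduct_comm w u]
    linarith [(abs_le.1 huw).2])) hτ0 hτ
  have h2 := h.measure_quadratic_ge_le hf (u - w) n (ε := 2 * ε) hB (hle _ (by
    simp only [sub_dotProduct, dotProduct_sub, dotProduct_comm w u]
    linarith [(abs_le.1 huw).1])) hτ0 hτ
  have hexp : τ * (2 * ε) / (4 * (8 * Real.pi * C * R)) = τ * ε / (2 * (8 * Real.pi * C * R)) := by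
    field_simp; ring
  rw [hexp] at h1 h2
  refine (measureReal_mono fun ω hω => ?_).trans ((measureReal_union_le _ _).trans
    ((add_le_add h1 h2).trans (le_of_eq (by ring))))
  have hω' : n * ε ≤ |∑ t : Fin n, (u ⬝ᵥ (y t ω).ofLp) * (w ⬝ᵥ (y t ω).ofLp)
    - n * (u ⬝ᵥ Sg.mulVec w)| := hω
  set Qp := ∑ t : Fin n, ((u + w) ⬝ᵥ (y t ω).ofLp) ^ 2 - n * ((u + w) ⬝ᵥ Sg.mulVec (u + w)) with hQp
  set Qm := ∑ t : Fin n, ((u - w) ⬝ᵥ (y t ω).ofLp) ^ 2 - n * ((u - w) ⬝ᵥ Sg.mulVec (u - w)) with hQm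
  have hpol : 4 * (∑ t : Fin n, (u ⬝ᵥ (y t ω).ofLp) * (w ⬝ᵥ (y t ω).ofLp)
      - n * (u ⬝ᵥ Sg.mulVec w)) = Qp - Qm := by
    rw [hQp, hQm]
    simp only [Matrix.mulVec_add, Matrix.mulVec_sub, add_dotProduct, dotProduct_add,
      sub_dotProduct, dotProduct_sub, hsym]
    have : ∑ t : Fin n, (u ⬝ᵥ (y t ω).ofLp + w ⬝ᵥ (y t ω).ofLp) ^ 2
        = ∑ t : Fin n, (u ⬝ᵥ (y t ω).ofLp - w ⬝ᵥ (y t ω).ofLp) ^ 2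
          + 4 * ∑ t : Fin n, (u ⬝ᵥ (y t ω).ofLp) * (w ⬝ᵥ (y t ω).ofLp) := by
      rw [Finset.mul_sum, ← Finset.sum_add_distrib]
      refine Finset.sum_congr rfl fun t _ => by ring
    rw [this]; ring
  by_contra hcon
  have hcon' : ¬ (n * (2 * ε) ≤ |Qp| ∨ n * (2 * ε) ≤ |Qm|) := hcon
  push Not at hcon'
  have h3 : 4 * |∑ t : Fin n, (u ⬝ᵥ (y t ω).ofLp) * (w ⬝ᵥ (y t ω).ofLp)
      - n * (u ⬝ᵥ Sg.mulVec w)| ≤ |Qp| + |Qm| := by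
    rw [← abs_of_nonneg (zero_le_four (α := ℝ)), ← abs_mul, hpol]
    exact abs_sub _ _
  linarith [hcon'.1, hcon'.2]

lemma secondMoment_lower (h : IsStationaryGaussianVAR P A S y e)
    (hf : ∀ θ : ℝ, ((C : ℂ) • (1 : Matrix (Fin p) (Fin p) ℂ)
      - varSpectralDensity A S θ).PosSemidef)
    (hS : (S - c • (1 : Matrix (Fin p) (Fin p) ℝ)).PosSemidef) (u : Fin p → ℝ) :
    c * (u ⬝ᵥ u) ≤ u ⬝ᵥ (secondMoment P y).mulVec u := by
  have h1 := dotProduct_mulVec_nonneg_real hS u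
  rw [Matrix.sub_mulVec, Matrix.smul_mulVec, Matrix.one_mulVec, dotProduct_sub, dotProduct_smul,
    smul_eq_mul] at h1
  have h2 := le_stationaryVariance h.stable h.noise_cov hf u
  rw [h.dotProduct_secondMoment_mulVec hf]
  linarith

lemma secondMoment_upper (h : IsStationaryGaussianVAR P A S y e)
    (hf : ∀ θ : ℝ, ((C : ℂ) • (1 : Matrix (Fin p) (Fin p) ℂ)
      - varSpectralDensity A S θ).PosSemidef) (u : Fin p → ℝ) :
    u ⬝ᵥ (secondMoment P y).mulVec u ≤ 2 * Real.pi * C * (u ⬝ᵥ u) := by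
  rw [h.dotProduct_secondMoment_mulVec hf]
  exact h.stationaryVariance_le hf u

end IsStationaryGaussianVAR

/-! ### Deterministic inequalities for the Lasso. -/

section Lasso

variable {n : ℕ} {ι : Type*} [Fintype ι]

/-- The basic inequality of the Lasso. -/
lemma lasso_basic_inequality (X : Matrix (Fin n) ι ℝ) (z : Fin n → ℝ) {g g₀ : ι → ℝ} {l z₀ : ℝ}
    (hmin : (∑ t, (z t - X.mulVec g t) ^ 2) / n + 2 * l * ∑ k, |g k|
      ≤ (∑ t, (z t - X.mulVec g₀ t) ^ 2) / n + 2 * l * ∑ k, |g₀ k|)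
    (hz : ∀ k, |∑ t, X t k * (z t - X.mulVec g₀ t)| / n ≤ z₀) :
    (∑ t, X.mulVec (g - g₀) t ^ 2) / n
      ≤ 2 * z₀ * ∑ k, |(g - g₀) k| + 2 * l * (∑ k, |g₀ k| - ∑ k, |g k|) := by
  set r : Fin n → ℝ := fun t => z t - X.mulVec g₀ t with hr
  set d := g - g₀ with hd
  have h1 : ∑ t, (z t - X.mulVec g t) ^ 2
      = ∑ t, r t ^ 2 - 2 * ∑ t, r t * X.mulVec d t + ∑ t, X.mulVec d t ^ 2 := by
    rw [Finset.mul_sum, ← Finset.sum_sub_distrib, ← Finset.sum_add_distrib]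
    refine Finset.sum_congr rfl fun t _ => ?_
    rw [hd, Matrix.mulVec_sub, Pi.sub_apply, hr]; ring
  have h2 : ∑ t, r t * X.mulVec d t = ∑ k, d k * ∑ t, X t k * r t := by
    simp only [Matrix.mulVec, dotProduct, Finset.mul_sum]
    rw [Finset.sum_comm]
    refine Finset.sum_congr rfl fun k _ => Finset.sum_congr rfl fun t _ => by ring
  have h3 : (∑ t, r t * X.mulVec d t) / n ≤ z₀ * ∑ k, |d k| := by
    rw [h2, Finset.sum_div, Finset.mul_sum]
    refine Finset.sum_le_sum fun k _ => ?_
    calc d k * (∑ t, X t k * r t) / n ≤ |d k * (∑ t, X t k * r t) / n| := le_abs_self _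
      _ = |d k| * (|∑ t, X t k * r t| / n) := by
        rw [abs_div, abs_mul, Nat.abs_cast, mul_div_assoc]
      _ ≤ |d k| * z₀ := mul_le_mul_of_nonneg_left (hz k) (abs_nonneg _)
      _ = z₀ * |d k| := mul_comm _ _
  rw [h1, add_div, sub_div, mul_div_assoc] at hmin
  linarith

/-- The cone inequality of the Lasso when the noise level is at most half the tuning
parameter. -/
lemma lasso_cone_inequality {g g₀ : ι → ℝ} {l z₀ V : ℝ} (hl : 2 * z₀ ≤ l)
    (hV : V ≤ 2 * z₀ * ∑ k, |(g - g₀) k| + 2 * l * (∑ k, |g₀ k| - ∑ k, |g k|)) (hl0 : 0 ≤ l) :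
    V + l * ∑ k, |(g - g₀) k| ≤ 4 * l * ∑ k with g₀ k ≠ 0, |(g - g₀) k| := by
  -- Coordinatewise: on the support the three terms contribute at most `l`, `2l` and `l` times `|d
  -- k|`; off it the penalty gives `-2l`, which outweighs the other two.
  have h1 : ∀ k, 2 * z₀ * |(g - g₀) k| + 2 * l * (|g₀ k| - |g k|) + l * |(g - g₀) k|
      ≤ if g₀ k ≠ 0 then 4 * l * |(g - g₀) k| else 0 := by
    intro k
    have hz := mul_le_mul_of_nonneg_right hl (abs_nonneg ((g - g₀) k))
    split_ifs with h
    · have h2 : |g₀ k| - |g k| ≤ |(g - g₀) k| := by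
        rw [Pi.sub_apply, abs_sub_comm]; exact abs_sub_abs_le_abs_sub _ _
      nlinarith [mul_le_mul_of_nonneg_left h2 hl0]
    · rw [not_not] at h
      rw [Pi.sub_apply, h] at hz ⊢
      simp only [sub_zero, abs_zero] at hz ⊢
      linarith
  have h2 := Finset.sum_le_sum fun k (_ : k ∈ Finset.univ) => h1 k
  rw [Finset.sum_add_distrib, Finset.sum_add_distrib, ← Finset.mul_sum, ← Finset.mul_sum,
    ← Finset.mul_sum, Finset.sum_sub_distrib, ← Finset.sum_filter, ← Finset.mul_sum] at h2
  linarith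

lemma sum_abs_le_sqrt_card_mul (s : Finset ι) (d : ι → ℝ) :
    ∑ k ∈ s, |d k| ≤ √(s.card : ℝ) * √(∑ k, d k ^ 2) := by
  rw [← Real.sqrt_mul (Nat.cast_nonneg _)]
  refine Real.le_sqrt_of_sq_le ?_
  refine (sq_sum_le_card_mul_sum_sq).trans ?_
  simp only [sq_abs]
  refine mul_le_mul_of_nonneg_left ?_ (Nat.cast_nonneg _)
  exact Finset.sum_le_sum_of_subset_of_nonneg (Finset.subset_univ _) fun _ _ _ => sq_nonneg _

/-- Restricted eigenvalue bound from entrywise closeness of the Gram matrix. -/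
lemma gram_lower_bound (X : Matrix (Fin n) ι ℝ) (G : Matrix ι ι ℝ) {c δ : ℝ} (d : ι → ℝ)
    (hG : c * ∑ k, d k ^ 2 ≤ d ⬝ᵥ G.mulVec d)
    (hδ : ∀ k l, |(∑ t, X t k * X t l) / n - G k l| ≤ δ) :
    c * ∑ k, d k ^ 2 ≤ (∑ t, X.mulVec d t ^ 2) / n + δ * (∑ k, |d k|) ^ 2 := by
  have h1 : (∑ t, X.mulVec d t ^ 2) / n = ∑ k, ∑ l, d k * d l * ((∑ t, X t k * X t l) / n) := by
    have : ∀ t, X.mulVec d t ^ 2 = ∑ k, ∑ l, d k * d l * (X t k * X t l) := by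
      intro t
      rw [sq, Matrix.mulVec, dotProduct, Finset.sum_mul_sum]
      refine Finset.sum_congr rfl fun k _ => Finset.sum_congr rfl fun l _ => by ring
    simp_rw [this]
    rw [Finset.sum_comm, Finset.sum_div]
    refine Finset.sum_congr rfl fun k _ => ?_
    rw [Finset.sum_comm, Finset.sum_div]
    refine Finset.sum_congr rfl fun l _ => ?_
    rw [← Finset.mul_sum, mul_div_assoc]
  have h2 : d ⬝ᵥ G.mulVec d = ∑ k, ∑ l, d k * d l * G k l := by
    simp only [dotProduct, Matrix.mulVec, Finset.mul_sum]
    refine Finset.sum_congr rfl fun k _ => Finset.sum_congr rfl fun l _ => by ring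
  have h3 : δ * (∑ k, |d k|) ^ 2 = ∑ k, ∑ l, |d k| * |d l| * δ := by
    rw [sq, Finset.sum_mul_sum, Finset.mul_sum]
    refine Finset.sum_congr rfl fun k _ => ?_
    rw [Finset.mul_sum]
    refine Finset.sum_congr rfl fun l _ => by ring
  refine hG.trans ?_
  rw [h1, h2, h3, ← Finset.sum_add_distrib]
  refine Finset.sum_le_sum fun k _ => ?_
  rw [← Finset.sum_add_distrib]
  refine Finset.sum_le_sum fun l _ => ?_
  have h4 := mul_le_mul_of_nonneg_left (hδ k l) (abs_nonneg (d k * d l))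
  rw [← abs_mul, mul_sub, abs_mul (d k) (d l)] at h4
  linarith [(abs_le.1 h4).1]

/-- Here `L` and `D` play the `ℓ¹` and `ℓ²` norms of the error, and `m²` an effective sparsity. By
`L ≤ mD` the Gram error `δL²` is absorbed by half of `cD²`, leaving `cD²/2 ≤ V ≤ amD`, which bounds
`D` and then the rest. -/
lemma lasso_rate {c δ a m V L D : ℝ} (hc : 0 < c) (ha : 0 ≤ a) (hm : 0 ≤ m) (hD : 0 ≤ D)
    (hL0 : 0 ≤ L) (hδ : 0 ≤ δ) (hL : L ≤ m * D) (hV : V ≤ a * m * D)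
    (hre : c * D ^ 2 ≤ V + δ * L ^ 2) (hδm : δ * m ^ 2 ≤ c / 2) :
    V ≤ 2 * a ^ 2 * m ^ 2 / c ∧ L ≤ 2 * a * m ^ 2 / c := by
  have h1 : δ * L ^ 2 ≤ c / 2 * D ^ 2 := by
    calc δ * L ^ 2 ≤ δ * (m * D) ^ 2 := by gcongr
      _ = δ * m ^ 2 * D ^ 2 := by ring
      _ ≤ c / 2 * D ^ 2 := by gcongr
  have h2 : D ≤ 2 * a * m / c := by
    rw [le_div_iff₀ hc]
    rcases hD.eq_or_lt with h | h
    · rw [← h]; simp; positivity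
    · refine le_of_mul_le_mul_right ?_ h
      nlinarith
  refine ⟨hV.trans ?_, hL.trans ?_⟩
  · calc a * m * D ≤ a * m * (2 * a * m / c) := by gcongr
      _ = _ := by ring
  · calc m * D ≤ m * (2 * a * m / c) := by gcongr
      _ = _ := by ring

end Lasso

/-! ### The population nodewise regression. -/

section Nodewise

variable {p : ℕ}

/-- The direction `e_j - γ_j` of the nodewise regression residual. -/
noncomputable def residualDirection (Sg : Matrix (Fin p) (Fin p) ℝ) (j : Fin p) : Fin p → ℝ :=
  fun i => if h : i = j then 1 else -nodewiseCoef Sg j ⟨i, h⟩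

lemma sum_eq_add_sum_subtype_ne (j : Fin p) (f : Fin p → ℝ) :
    ∑ i, f i = f j + ∑ k : {k // k ≠ j}, f k := by
  rw [← Finset.add_sum_erase _ _ (Finset.mem_univ j)]
  congr 1
  rw [← Finset.sum_subtype (Finset.univ.erase j) (by simp) f]

lemma dotProduct_residualDirection (Sg : Matrix (Fin p) (Fin p) ℝ) (j : Fin p) (x : Fin p → ℝ) :
    residualDirection Sg j ⬝ᵥ x = x j - ∑ k : {k // k ≠ j}, x k * nodewiseCoef Sg j k := by
  rw [dotProduct, sum_eq_add_sum_subtype_ne j, residualDirection, dif_pos rfl, one_mul,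
    sub_eq_add_neg, ← Finset.sum_neg_distrib]
  congr 1
  refine Finset.sum_congr rfl fun k _ => ?_
  rw [residualDirection, dif_neg k.2]; simp only [Subtype.coe_eta]; ring

/-- The extension of `d` by zero at `j`. -/
def extendZero (j : Fin p) (d : {k // k ≠ j} → ℝ) : Fin p → ℝ :=
  fun i => if h : i = j then 0 else d ⟨i, h⟩

lemma extendZero_dotProduct (j : Fin p) (d : {k // k ≠ j} → ℝ) (x : Fin p → ℝ) :
    extendZero j d ⬝ᵥ x = ∑ k, d k * x k := by
  rw [dotProduct, sum_eq_add_sum_subtype_ne j, extendZero, dif_pos rfl, zero_mul, zero_add]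
  refine Finset.sum_congr rfl fun k _ => ?_
  rw [extendZero, dif_neg k.2]

lemma extendZero_apply_coe (j : Fin p) (d : {k // k ≠ j} → ℝ) (k : {k // k ≠ j}) :
    extendZero j d k = d k := by
  rw [extendZero, dif_neg k.2]

variable {Sg : Matrix (Fin p) (Fin p) ℝ} {c C : ℝ}

lemma submatrix_lower_bound (hlow : ∀ u : Fin p → ℝ, c * (u ⬝ᵥ u) ≤ u ⬝ᵥ Sg.mulVec u) (j : Fin p)
    (d : {k // k ≠ j} → ℝ) :
    c * ∑ k, d k ^ 2 ≤ d ⬝ᵥ (Sg.submatrix Subtype.val Subtype.val).mulVec d := by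
  have h := hlow (extendZero j d)
  rw [extendZero_dotProduct, extendZero_dotProduct] at h
  simp_rw [extendZero_apply_coe, ← sq] at h
  refine h.trans (le_of_eq ?_)
  refine Finset.sum_congr rfl fun k _ => ?_
  congr 1
  rw [Matrix.mulVec, dotProduct_comm, extendZero_dotProduct]
  refine Finset.sum_congr rfl fun l _ => ?_
  simp [mul_comm]

/-- The normal equations of the nodewise regression. -/
lemma mulVec_residualDirection (hc : 0 < c) (hsym : Sg.transpose = Sg)
    (hlow : ∀ u : Fin p → ℝ, c * (u ⬝ᵥ u) ≤ u ⬝ᵥ Sg.mulVec u) {j k : Fin p} (hk : k ≠ j) :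
    Sg.mulVec (residualDirection Sg j) k = 0 := by
  set M : Matrix {k // k ≠ j} {k // k ≠ j} ℝ := Sg.submatrix Subtype.val Subtype.val with hM
  have hpd : M.PosDef := by
    refine Matrix.PosDef.of_dotProduct_mulVec_pos ?_ fun x hx => ?_
    · rw [hM]
      exact Matrix.IsHermitian.submatrix (by
        rw [Matrix.IsHermitian, Matrix.conjTranspose_eq_transpose_of_trivial, hsym]) _
    · have h1 := submatrix_lower_bound hlow j x
      have h2 : 0 < ∑ k, x k ^ 2 := by
        obtain ⟨i, hi⟩ := Function.ne_iff.1 hx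
        exact Finset.sum_pos' (fun _ _ => sq_nonneg _) ⟨i, Finset.mem_univ _, by
          have : x i ≠ 0 := hi
          positivity⟩
      have h3 := mul_pos hc h2
      rw [star_trivial]
      linarith
  have hdet : IsUnit M.det := (Matrix.isUnit_iff_isUnit_det _).1 hpd.isUnit
  have hne : M.mulVec (nodewiseCoef Sg j) = fun k => Sg k.1 j := by
    rw [nodewiseCoef, Matrix.mulVec_mulVec, ← hM, Matrix.mul_nonsing_inv _ hdet, Matrix.one_mulVec]
  have h := congrFun hne ⟨k, hk⟩
  rw [Matrix.mulVec, dotProduct_comm, dotProduct_residualDirection]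
  rw [← h]
  simp [Matrix.mulVec, dotProduct, hM]

/-- The basis vector at `j` is the sum of the residual direction `w` and a vector orthogonal to it
for `Sg`. By Pythagoras `c|w|² ≤ wᵀ Sg w ≤ Sg j j ≤ C`. -/
lemma residualDirection_dotProduct_self_le (hc : 0 < c) (hsym : Sg.transpose = Sg)
    (hlow : ∀ u : Fin p → ℝ, c * (u ⬝ᵥ u) ≤ u ⬝ᵥ Sg.mulVec u)
    (hup : ∀ u : Fin p → ℝ, u ⬝ᵥ Sg.mulVec u ≤ C * (u ⬝ᵥ u)) (j : Fin p) :
    residualDirection Sg j ⬝ᵥ residualDirection Sg j ≤ C / c := by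
  set w := residualDirection Sg j with hw
  set g := extendZero j (nodewiseCoef Sg j) with hg
  have he : (Pi.single j 1 : Fin p → ℝ) = w + g := by
    ext i
    rcases eq_or_ne i j with rfl | h
    · simp [hw, hg, residualDirection, extendZero]
    · simp [hw, hg, residualDirection, extendZero, h]
  have hgw : g ⬝ᵥ Sg.mulVec w = 0 := by
    rw [hg, extendZero_dotProduct]
    refine Finset.sum_eq_zero fun k _ => ?_
    rw [mulVec_residualDirection hc hsym hlow k.2, mul_zero]
  have hwg : w ⬝ᵥ Sg.mulVec g = 0 := by
    rw [Matrix.dotProduct_mulVec, ← Matrix.mulVec_transpose, hsym, dotProduct_comm, hgw]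
  have h1 := hup (Pi.single j 1)
  have h0 : (Pi.single j 1 : Fin p → ℝ) ⬝ᵥ Pi.single j 1 = 1 := by simp
  rw [h0, he, Matrix.mulVec_add, dotProduct_add, add_dotProduct, add_dotProduct, hgw, hwg] at h1
  have h2 := hlow g
  have h3 := mul_nonneg hc.le (dotProduct_self_nonneg_real g)
  have h4 := hlow w
  rw [le_div_iff₀ hc]
  linarith

end Nodewise

/-! ### Deterministic rates for the nodewise Lasso. -/

section Deterministic

variable {n p : ℕ} {X : Matrix (Fin n) (Fin p) ℝ} {Sg : Matrix (Fin p) (Fin p) ℝ} {j : Fin p}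
  {g : {k // k ≠ j} → ℝ} {l z₀ δ c : ℝ}

lemma nodewise_basic_inequality (hg : IsNodewiseLasso X j l g)
    (hz : ∀ k, k ≠ j → |∑ t, X t k * (residualDirection Sg j ⬝ᵥ X t)| / n ≤ z₀) :
    (∑ t, (X.submatrix id Subtype.val).mulVec (g - nodewiseCoef Sg j) t ^ 2) / n
      ≤ 2 * z₀ * ∑ k, |(g - nodewiseCoef Sg j) k|
        + 2 * l * (∑ k, |nodewiseCoef Sg j k| - ∑ k, |g k|) := by
  refine lasso_basic_inequality (X.submatrix id Subtype.val) (fun t => X t j)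
    (hg (nodewiseCoef Sg j)) fun k => ?_
  refine le_of_eq_of_le ?_ (hz k k.2)
  congr 2
  refine Finset.sum_congr rfl fun t _ => ?_
  rw [dotProduct_residualDirection]
  rfl

lemma nodewiseSparsity_eq_card (Sg : Matrix (Fin p) (Fin p) ℝ) (j : Fin p) :
    nodewiseSparsity Sg j = (Finset.univ.filter fun k => nodewiseCoef Sg j k ≠ 0).card := by
  rw [nodewiseSparsity, ← Set.ncard_coe_finset]
  simp

lemma two_le_of_nodewiseSparsity (h : 1 ≤ nodewiseSparsity Sg j) : 2 ≤ p := by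
  rw [nodewiseSparsity_eq_card] at h
  obtain ⟨k, -⟩ := Finset.card_pos.1 h
  by_contra hp
  exact k.2 (Fin.ext (by have := k.1.2; have := j.2; omega))

lemma nodewise_gram_lower_bound (hlow : ∀ u : Fin p → ℝ, c * (u ⬝ᵥ u) ≤ u ⬝ᵥ Sg.mulVec u)
    (hδ : ∀ k l, |(∑ t, X t k * X t l) / n - Sg k l| ≤ δ) (d : {k // k ≠ j} → ℝ) :
    c * √(∑ k, d k ^ 2) ^ 2 ≤ (∑ t, (X.submatrix id Subtype.val).mulVec d t ^ 2) / n
      + δ * (∑ k, |d k|) ^ 2 := by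
  rw [Real.sq_sqrt (Finset.sum_nonneg fun _ _ => sq_nonneg _)]
  exact gram_lower_bound _ _ d (submatrix_lower_bound hlow j d) fun k l => hδ k l

/-- Rates of the nodewise Lasso when the tuning parameter dominates the noise. -/
lemma nodewise_rate_of_noise_le (hc : 0 < c)
    (hlow : ∀ u : Fin p → ℝ, c * (u ⬝ᵥ u) ≤ u ⬝ᵥ Sg.mulVec u) (hl : 0 < l) (hzl : 2 * z₀ ≤ l)
    (hδ0 : 0 ≤ δ) (hg : IsNodewiseLasso X j l g)
    (hz : ∀ k, k ≠ j → |∑ t, X t k * (residualDirection Sg j ⬝ᵥ X t)| / n ≤ z₀)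
    (hgram : 1 ≤ nodewiseSparsity Sg j → (∀ k l, |(∑ t, X t k * X t l) / n - Sg k l| ≤ δ) ∧
      16 * δ * nodewiseSparsity Sg j ≤ c / 2) :
    (∑ t, (X.submatrix id Subtype.val).mulVec (g - nodewiseCoef Sg j) t ^ 2) / n
        ≤ 32 * l ^ 2 * nodewiseSparsity Sg j / c ∧
      ∑ k, |(g - nodewiseCoef Sg j) k| ≤ 32 * l * nodewiseSparsity Sg j / c := by
  set d := g - nodewiseCoef Sg j with hd
  set V := (∑ t, (X.submatrix id Subtype.val).mulVec d t ^ 2) / n with hV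
  set q := nodewiseSparsity Sg j with hq
  have hV0 : 0 ≤ V := div_nonneg (Finset.sum_nonneg fun _ _ => sq_nonneg _) (Nat.cast_nonneg _)
  have hL0 : 0 ≤ ∑ k, |d k| := Finset.sum_nonneg fun _ _ => abs_nonneg _
  have hcone := lasso_cone_inequality hzl (nodewise_basic_inequality hg hz) hl.le
  rw [← hd, ← hV] at hcone
  have hs := sum_abs_le_sqrt_card_mul (Finset.univ.filter fun k => nodewiseCoef Sg j k ≠ 0) d
  rw [← nodewiseSparsity_eq_card, ← hq] at hs
  have hs' := mul_le_mul_of_nonneg_left hs (by positivity : 0 ≤ 4 * l)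
  have hsq : √(q : ℝ) ^ 2 = q := Real.sq_sqrt (Nat.cast_nonneg _)
  have hL : ∑ k, |d k| ≤ 4 * √(q : ℝ) * √(∑ k, d k ^ 2) := by
    refine le_of_mul_le_mul_left ?_ hl
    linarith
  have hVb : V ≤ l * (4 * √(q : ℝ)) * √(∑ k, d k ^ 2) := by
    have := mul_nonneg hl.le hL0
    linarith
  -- With empty support the cone inequality already forces both errors to vanish, so no Gram bound
  -- is needed.
  rcases Nat.eq_zero_or_pos q with h0 | h1
  · rw [h0] at hL hVb ⊢
    simp only [Nat.cast_zero, Real.sqrt_zero, mul_zero, zero_mul, zero_div] at hL hVb ⊢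
    exact ⟨hVb, hL⟩
  · obtain ⟨hgr, hδq⟩ := hgram h1
    have := lasso_rate hc hl.le (by positivity) (Real.sqrt_nonneg _) hL0 hδ0 hL hVb
      (nodewise_gram_lower_bound hlow hgr d) (by rw [mul_pow, hsq]; linarith)
    refine ⟨this.1.trans (le_of_eq ?_), this.2.trans (le_of_eq ?_)⟩
    · rw [mul_pow, hsq]; ring
    · rw [mul_pow, hsq]; ring

/-- Rates of the nodewise Lasso in fixed dimension. -/
lemma nodewise_rate_of_dim (hc : 0 < c)
    (hlow : ∀ u : Fin p → ℝ, c * (u ⬝ᵥ u) ≤ u ⬝ᵥ Sg.mulVec u) (hl : 0 ≤ l) (hz0 : 0 ≤ z₀)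
    (hδ0 : 0 ≤ δ) (hg : IsNodewiseLasso X j l g)
    (hz : ∀ k, k ≠ j → |∑ t, X t k * (residualDirection Sg j ⬝ᵥ X t)| / n ≤ z₀)
    (hgram : ∀ k l, |(∑ t, X t k * X t l) / n - Sg k l| ≤ δ) (hδp : δ * p ≤ c / 2) :
    (∑ t, (X.submatrix id Subtype.val).mulVec (g - nodewiseCoef Sg j) t ^ 2) / n
        ≤ 8 * (z₀ + l) ^ 2 * p / c ∧
      ∑ k, |(g - nodewiseCoef Sg j) k| ≤ 4 * (z₀ + l) * p / c := by
  set d := g - nodewiseCoef Sg j with hd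
  have hL0 : 0 ≤ ∑ k, |d k| := Finset.sum_nonneg fun _ _ => abs_nonneg _
  have hsq : √(p : ℝ) ^ 2 = p := Real.sq_sqrt (Nat.cast_nonneg _)
  have hcard : ((Finset.univ : Finset {k // k ≠ j}).card : ℝ) ≤ p := by
    rw [Finset.card_univ]
    exact_mod_cast (Fintype.card_subtype_le _).trans (Fintype.card_fin p).le
  have hL : ∑ k, |d k| ≤ √(p : ℝ) * √(∑ k, d k ^ 2) :=
    (sum_abs_le_sqrt_card_mul Finset.univ d).trans (by gcongr)
  have hdiff : ∑ k, |nodewiseCoef Sg j k| - ∑ k, |g k| ≤ ∑ k, |d k| := by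
    rw [← Finset.sum_sub_distrib]
    refine Finset.sum_le_sum fun k _ => ?_
    rw [hd, Pi.sub_apply, abs_sub_comm]; exact abs_sub_abs_le_abs_sub _ _
  have hV := nodewise_basic_inequality hg hz
  rw [← hd] at hV
  have hVb : (∑ t, (X.submatrix id Subtype.val).mulVec d t ^ 2) / n
      ≤ 2 * (z₀ + l) * √(p : ℝ) * √(∑ k, d k ^ 2) := by
    have h1 := mul_le_mul_of_nonneg_left hdiff (by positivity : 0 ≤ 2 * l)
    have h2 := mul_le_mul_of_nonneg_left hL (by positivity : 0 ≤ 2 * (z₀ + l))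
    linarith
  have := lasso_rate hc (by positivity) (Real.sqrt_nonneg _) (Real.sqrt_nonneg _) hL0 hδ0 hL hVb
    (nodewise_gram_lower_bound hlow hgram d) (by rw [hsq]; exact hδp)
  refine ⟨this.1.trans (le_of_eq ?_), this.2.trans (le_of_eq ?_)⟩
  · rw [hsq]; ring
  · rw [hsq]; ring

end Deterministic

/-! ### Probabilities of the Gram and noise events. -/

lemma measureReal_exists_le {Ω ι : Type*} [MeasurableSpace Ω] [Fintype ι] {P : Measure Ω}
    [IsFiniteMeasure P] {Q : ι → Ω → Prop} {b : ℝ} (hb : ∀ i, P.real {ω | Q i ω} ≤ b) :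
    P.real {ω | ∃ i, Q i ω} ≤ Fintype.card ι * b := by
  have h1 : {ω | ∃ i, Q i ω} = ⋃ i ∈ Finset.univ, {ω | Q i ω} := by
    ext ω; simp
  rw [h1]
  refine (measureReal_biUnion_finset_le _ _).trans ((Finset.sum_le_sum fun i _ => hb i).trans ?_)
  simp

namespace IsStationaryGaussianVAR

variable {Ω : Type*} [MeasurableSpace Ω] {P : Measure Ω} {p : ℕ}
  {A S : Matrix (Fin p) (Fin p) ℝ} {y e : ℕ → Ω → EuclideanSpace ℝ (Fin p)} {c C : ℝ}

/-- Union bound over the `p²` pairs, with `τ = √(log p / n)`; it costs `2 log p` in the exponent. -/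
lemma measure_gram_gt_le (h : IsStationaryGaussianVAR P A S y e) (hC : 0 < C)
    (hf : ∀ θ : ℝ, ((C : ℂ) • (1 : Matrix (Fin p) (Fin p) ℂ)
      - varSpectralDensity A S θ).PosSemidef) {n : ℕ} (hn : 0 < n) (hp : 2 ≤ p)
    {B D : ℝ} (hB : 8 * Real.pi * C ≤ B) (hr : √(Real.log p / n) ≤ 1) :
    P.real {ω | ∃ kl : Fin p × Fin p, 2 * B * D * √(Real.log p / n)
        < |(∑ t, designMatrix n y ω t kl.1 * designMatrix n y ω t kl.2) / n
          - secondMoment P y kl.1 kl.2|}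
      ≤ 4 * Real.exp (-((D - 3) * Real.log p)) := by
  have := h.isProb
  set r := √(Real.log p / n) with hrd
  have hn' : (0 : ℝ) < n := by exact_mod_cast hn
  have hp' : (2 : ℝ) ≤ p := by exact_mod_cast hp
  have hlog : 0 ≤ Real.log p := Real.log_nonneg (by linarith)
  have hr2 : n * r ^ 2 = Real.log p := by
    rw [hrd, Real.sq_sqrt (by positivity)]; field_simp
  have hpos : 0 < 8 * Real.pi * C := by positivity
  have hB0 : 0 < B := hpos.trans_le hB
  -- Any radius at least `1` is admissible for basis vectors; this one makes the constant of the
  -- bilinear bound equal to `B`.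
  set R := B / (8 * Real.pi * C) with hR
  have hR1 : 1 ≤ R := (one_le_div hpos).2 hB
  have hRB : 8 * Real.pi * C * R = B := by rw [hR]; field_simp
  refine (measureReal_exists_le (b := 4 * Real.exp (-((D - 1) * Real.log p))) fun kl => ?_).trans
    (le_of_eq ?_)
  · have hs : ∀ k : Fin p, (Pi.single k 1 : Fin p → ℝ) ⬝ᵥ Pi.single k 1 ≤ R := fun k => by
      simpa using hR1
    have hb := h.measure_bilinear_ge_le hC hf (Pi.single kl.1 1) (Pi.single kl.2 1) n
      (ε := 2 * B * D * r) (by linarith) (hs _) (hs _) (Real.sqrt_nonneg _) hr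
    refine (measureReal_mono fun ω hω => ?_).trans (hb.trans ?_)
    · have hω' : 2 * B * D * r < |(∑ t, designMatrix n y ω t kl.1 * designMatrix n y ω t kl.2) / n
          - secondMoment P y kl.1 kl.2| := hω
      have h1 : ∑ t : Fin n, ((Pi.single kl.1 1 : Fin p → ℝ) ⬝ᵥ (y t ω).ofLp) *
          ((Pi.single kl.2 1 : Fin p → ℝ) ⬝ᵥ (y t ω).ofLp) - n * ((Pi.single kl.1 1 : Fin p → ℝ) ⬝ᵥ
            (secondMoment P y).mulVec (Pi.single kl.2 1))
          = n * ((∑ t, designMatrix n y ω t kl.1 * designMatrix n y ω t kl.2) / n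
            - secondMoment P y kl.1 kl.2) := by
        rw [mul_sub, mul_div_cancel₀ _ hn'.ne']
        simp [designMatrix]
      change n * (2 * B * D * r) ≤ |_|
      rw [h1, abs_mul, Nat.abs_cast]
      exact mul_le_mul_of_nonneg_left hω'.le hn'.le
    · rw [hRB]
      have h2 : n * (r * (2 * B * D * r) / (2 * B) - r ^ 2 / 8)
          = (D - 1 / 8) * Real.log p := by
        rw [← hr2]; field_simp
      rw [h2]
      gcongr
      norm_num
  · rw [Fintype.card_prod, Fintype.card_fin]
    have h3 : Real.exp (-((D - 3) * Real.log p))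
        = p * p * Real.exp (-((D - 1) * Real.log p)) := by
      have h4 : Real.exp (Real.log p) = p := Real.exp_log (by linarith)
      rw [← h4, Real.log_exp, ← Real.exp_add, ← Real.exp_add]; congr 1; ring
    rw [h3]; push_cast; ring

/-- By the normal equations the products have mean zero. No relation between `log p` and `n` is
assumed: a large `log p / n` can still occur when `q_j = 0`, and is treated separately. -/
lemma measure_noise_gt_le (h : IsStationaryGaussianVAR P A S y e) (hc : 0 < c) (hC : 0 < C)
    (hS : (S - c • (1 : Matrix (Fin p) (Fin p) ℝ)).PosSemidef)
    (hf : ∀ θ : ℝ, ((C : ℂ) • (1 : Matrix (Fin p) (Fin p) ℂ)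
      - varSpectralDensity A S θ).PosSemidef) {n : ℕ} (hn : 0 < n) (hp : 2 ≤ p) (j : Fin p)
    {B D : ℝ} (hB : B = 8 * Real.pi * C * (1 + 2 * Real.pi * C / c)) (hD : 1 ≤ D) :
    P.real {ω | ∃ k : {k // k ≠ j}, 5 * B * D * √(Real.log p / n)
        < |∑ t, designMatrix n y ω t k *
          (residualDirection (secondMoment P y) j ⬝ᵥ designMatrix n y ω t)| / n}
      ≤ 4 * Real.exp (-((D - 2) * Real.log p)) + 2 * Real.exp (-(n * (D - 1))) := by
  have := h.isProb
  set r := √(Real.log p / n) with hrd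
  set w := residualDirection (secondMoment P y) j with hw
  set R := 1 + 2 * Real.pi * C / c with hR
  have hn' : (0 : ℝ) < n := by exact_mod_cast hn
  have hp' : (2 : ℝ) ≤ p := by exact_mod_cast hp
  have hlog : 0 ≤ Real.log p := Real.log_nonneg (by linarith)
  have hr0 : 0 ≤ r := Real.sqrt_nonneg _
  have hr2 : n * r ^ 2 = Real.log p := by
    rw [hrd, Real.sq_sqrt (by positivity)]; field_simp
  have hpos : 0 < 2 * Real.pi * C := by positivity
  have hR1 : 1 ≤ R := le_add_of_nonneg_right (by positivity)
  have hB0 : 0 < B := by rw [hB]; positivity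
  have hwR : w ⬝ᵥ w ≤ R := (residualDirection_dotProduct_self_le hc secondMoment_transpose
    (h.secondMoment_lower hf hS) (h.secondMoment_upper hf) j).trans (by rw [hR]; linarith)
  have hsR : ∀ k : Fin p, (Pi.single k 1 : Fin p → ℝ) ⬝ᵥ Pi.single k 1 ≤ R := fun k => by
    simpa using hR1
  have hBR : ∀ u : Fin p → ℝ, u ⬝ᵥ u ≤ R → 2 * Real.pi * C * (u ⬝ᵥ u) ≤ B := fun u hu => by
    have := mul_le_mul_of_nonneg_left hu hpos.le
    have h4 : B = 4 * (2 * Real.pi * C * R) := by rw [hB]; ring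
    have : 0 ≤ 2 * Real.pi * C * R := by positivity
    linarith
  have hcard : (Fintype.card {k // k ≠ j} : ℝ) ≤ p := by
    exact_mod_cast (Fintype.card_subtype_le _).trans (Fintype.card_fin p).le
  have hexp : Real.exp (-((D - 2) * Real.log p)) = p * Real.exp (-((D - 1) * Real.log p)) := by
    have h4 : Real.exp (Real.log p) = p := Real.exp_log (by linarith)
    rw [← h4, Real.log_exp, ← Real.exp_add]; congr 1; ring
  have hsplit : ∀ k, (∀ ω, ∑ t, designMatrix n y ω t k * (w ⬝ᵥ designMatrix n y ω t)
      = ∑ t : Fin n, ((Pi.single k 1 : Fin p → ℝ) ⬝ᵥ (y t ω).ofLp) * (w ⬝ᵥ (y t ω).ofLp)) := by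
    intro k ω
    refine Finset.sum_congr rfl fun t _ => ?_
    rw [single_one_dotProduct]
    rfl
  simp_rw [hsplit]
  rcases le_total r 1 with hr1 | hr1
  · have hk : ∀ k : {k // k ≠ j}, P.real {ω | 5 * B * D * r < |∑ t : Fin n,
        ((Pi.single k.1 1 : Fin p → ℝ) ⬝ᵥ (y t ω).ofLp) * (w ⬝ᵥ (y t ω).ofLp)| / n}
        ≤ 4 * Real.exp (-((D - 1) * Real.log p)) := by
      intro k
      have hb := h.measure_bilinear_ge_le hC hf (Pi.single k.1 1) w n
        (ε := 2 * B * D * r) (by linarith) (hsR _) hwR hr0 hr1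
      have h0 : (Pi.single k.1 1 : Fin p → ℝ) ⬝ᵥ (secondMoment P y).mulVec w = 0 := by
        rw [single_one_dotProduct, hw, mulVec_residualDirection hc secondMoment_transpose
          (h.secondMoment_lower hf hS) k.2]
      rw [h0, mul_zero] at hb
      simp only [sub_zero] at hb
      refine (measureReal_mono fun ω hω => ?_).trans (hb.trans ?_)
      · have hω' : 5 * B * D * r < |∑ t : Fin n,
          ((Pi.single k.1 1 : Fin p → ℝ) ⬝ᵥ (y t ω).ofLp) * (w ⬝ᵥ (y t ω).ofLp)| / n := hω
        rw [lt_div_iff₀ hn'] at hω'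
        change n * (2 * B * D * r) ≤ |_|
        have : 0 ≤ B * D * r * n := by positivity
        linarith
      · rw [← hB]
        have h2 : n * (r * (2 * B * D * r) / (2 * B) - r ^ 2 / 8)
            = (D - 1 / 8) * Real.log p := by
          rw [← hr2]; field_simp
        rw [h2]
        gcongr
        norm_num
    refine (measureReal_exists_le hk).trans ?_
    rw [hexp]
    have h5 := mul_le_mul_of_nonneg_right hcard
      (by positivity : 0 ≤ 4 * Real.exp (-((D - 1) * Real.log p)))
    have h6 : 0 ≤ 2 * Real.exp (-(n * (D - 1))) := by positivity
    linarith
  -- Now `n ≤ log p` and `τ` is capped at `1`. The columns and the residual are bounded in norm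
  -- separately: the columns up to a factor `r²`, which pays for the union bound, the residual
  -- without it.
  · have hr1' : 1 ≤ r ^ 2 := one_le_pow₀ hr1
    have hnlog : n ≤ Real.log p := by rw [← hr2]; nlinarith
    have hE1 : ∀ k : {k // k ≠ j}, P.real {ω | n * (4 * B * D * r ^ 2) ≤
        |∑ t : Fin n, ((Pi.single k.1 1 : Fin p → ℝ) ⬝ᵥ (y t ω).ofLp) ^ 2
          - n * ((Pi.single k.1 1 : Fin p → ℝ) ⬝ᵥ (secondMoment P y).mulVec (Pi.single k.1 1))|}
        ≤ 2 * Real.exp (-((D - 1) * Real.log p)) := by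
      intro k
      refine (h.measure_quadratic_ge_le hf _ n hB0 (hBR _ (hsR k.1)) zero_le_one le_rfl).trans ?_
      have h2 : n * (1 * (4 * B * D * r ^ 2) / (4 * B) - 1 ^ 2 / 8)
          = D * Real.log p - n / 8 := by
        rw [← hr2]; field_simp
      rw [h2]
      gcongr
      linarith
    have hE2 : P.real {ω | n * (4 * B * D) ≤ |∑ t : Fin n, (w ⬝ᵥ (y t ω).ofLp) ^ 2
          - n * (w ⬝ᵥ (secondMoment P y).mulVec w)|} ≤ 2 * Real.exp (-(n * (D - 1))) := by
      refine (h.measure_quadratic_ge_le hf _ n hB0 (hBR _ hwR) zero_le_one le_rfl).trans ?_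
      have h2 : n * (1 * (4 * B * D) / (4 * B) - 1 ^ 2 / 8) = n * (D - 1 / 8) := by
        field_simp
      rw [h2]
      gcongr
      norm_num
    have hE1' := measureReal_exists_le hE1
    refine (measureReal_mono fun ω hω => ?_).trans ((measureReal_union_le _ _).trans
      ((add_le_add hE1' hE2).trans ?_))
    · by_contra hcon
      simp only [Set.mem_union, not_or] at hcon
      obtain ⟨hc1, hc2⟩ := hcon
      have hc1' : ¬ ∃ k : {k // k ≠ j}, n * (4 * B * D * r ^ 2) ≤
        |∑ t : Fin n, ((Pi.single k.1 1 : Fin p → ℝ) ⬝ᵥ (y t ω).ofLp) ^ 2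
          - n * ((Pi.single k.1 1 : Fin p → ℝ) ⬝ᵥ (secondMoment P y).mulVec (Pi.single k.1 1))| :=
        hc1
      have hc2' : ¬ n * (4 * B * D) ≤ |∑ t : Fin n, (w ⬝ᵥ (y t ω).ofLp) ^ 2
          - n * (w ⬝ᵥ (secondMoment P y).mulVec w)| := hc2
      push Not at hc1' hc2'
      obtain ⟨k, hk⟩ : ∃ k : {k // k ≠ j}, 5 * B * D * r < |∑ t : Fin n,
        ((Pi.single k.1 1 : Fin p → ℝ) ⬝ᵥ (y t ω).ofLp) * (w ⬝ᵥ (y t ω).ofLp)| / n := hω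
      have hk1 := (abs_lt.1 (hc1' k)).2
      have hk2 := (abs_lt.1 hc2').2
      have hm : ∀ u : Fin p → ℝ, u ⬝ᵥ u ≤ R → n * (u ⬝ᵥ (secondMoment P y).mulVec u) ≤ n * B :=
        fun u hu => mul_le_mul_of_nonneg_left
          ((h.secondMoment_upper hf u).trans (hBR u hu)) hn'.le
      have hm1 := hm _ (hsR k.1)
      have hm2 := hm _ hwR
      have hnB : 0 ≤ n * B := by positivity
      have hDr : 1 ≤ D * r ^ 2 := by nlinarith
      have ha1 : ∑ t : Fin n, ((Pi.single k.1 1 : Fin p → ℝ) ⬝ᵥ (y t ω).ofLp) ^ 2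
          ≤ 5 * (n * B) * (D * r ^ 2) := by nlinarith
      have ha2 : ∑ t : Fin n, (w ⬝ᵥ (y t ω).ofLp) ^ 2 ≤ 5 * (n * B) * D := by nlinarith
      -- Cauchy–Schwarz: the factors `D r²` and `D` combine to `(D r)²`. The `5` is `4` from the
      -- deviation plus `1` from the mean.
      have hcs := Finset.sum_mul_sq_le_sq_mul_sq Finset.univ
        (fun t : Fin n => (Pi.single k.1 1 : Fin p → ℝ) ⬝ᵥ (y t ω).ofLp)
        (fun t : Fin n => w ⬝ᵥ (y t ω).ofLp)
      have h7 := hcs.trans (mul_le_mul ha1 ha2 (Finset.sum_nonneg fun _ _ => sq_nonneg _)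
        (by positivity))
      have h8 : 5 * (n * B) * (D * r ^ 2) * (5 * (n * B) * D) = (5 * B * D * r * n) ^ 2 := by ring
      rw [h8] at h7
      have h9 := abs_le_of_sq_le_sq h7 (by positivity)
      rw [lt_div_iff₀ hn'] at hk
      exact absurd h9 (not_le.2 hk)
    · rw [hexp]
      have h5 := mul_le_mul_of_nonneg_right hcard
        (by positivity : 0 ≤ 2 * Real.exp (-((D - 1) * Real.log p)))
      have h6 : 0 ≤ p * Real.exp (-((D - 1) * Real.log p)) := by positivity
      linarith

end IsStationaryGaussianVAR

/-! ### From the two events to the uniform rates. -/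

/-- A nonzero coefficient forces `p ≥ 2`, so `√(log p)` is at most a constant times `log p`. The
sparsity assumption thus makes `q_j √(log p / n)` small. -/
lemma nodewiseSparsity_mul_rate_le {p n : ℕ} {Sg : Matrix (Fin p) (Fin p) ℝ} {j : Fin p}
    (hj : 1 ≤ nodewiseSparsity Sg j) :
    nodewiseSparsity Sg j * √(Real.log p / n)
      ≤ ((Finset.univ.sup (nodewiseSparsity Sg) : ℕ) : ℝ) * Real.log p / √(n : ℝ)
        / √(Real.log 2) := by
  have hp : (2 : ℝ) ≤ p := by exact_mod_cast two_le_of_nodewiseSparsity hj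
  have hlog2 : 0 < Real.log 2 := Real.log_pos (by norm_num)
  have hlog : Real.log 2 ≤ Real.log p := Real.log_le_log (by norm_num) hp
  have hlog0 : 0 ≤ Real.log p := hlog2.le.trans hlog
  have hle : (nodewiseSparsity Sg j : ℝ) ≤ ((Finset.univ.sup (nodewiseSparsity Sg) : ℕ) : ℝ) := by
    exact_mod_cast Finset.le_sup (f := nodewiseSparsity Sg) (Finset.mem_univ j)
  have h1 : √(Real.log p) ≤ Real.log p / √(Real.log 2) := by
    rw [le_div_iff₀ (Real.sqrt_pos.2 hlog2)]
    calc √(Real.log p) * √(Real.log 2) ≤ √(Real.log p) * √(Real.log p) := by gcongr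
      _ = Real.log p := Real.mul_self_sqrt hlog0
  rw [Real.sqrt_div hlog0, div_right_comm, mul_div_assoc, mul_div_assoc, ← mul_div_assoc,
    mul_div_assoc]
  calc (nodewiseSparsity Sg j : ℝ) * (√(Real.log p) / √(n : ℝ))
      ≤ ((Finset.univ.sup (nodewiseSparsity Sg) : ℕ) : ℝ)
        * (Real.log p / √(Real.log 2) / √(n : ℝ)) := by gcongr
    _ = _ := by ring

/-- With high probability the nodewise Lasso attains its rates, when the dimension is either
large or the regression is not null. -/
lemma measure_nodewise_rate_le {Ω : Type*} [MeasurableSpace Ω] {P : Measure Ω} {p n p₀ : ℕ}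
    {A S : Matrix (Fin p) (Fin p) ℝ} {y e : ℕ → Ω → EuclideanSpace ℝ (Fin p)}
    {c C B D K l ε : ℝ} {j : Fin p} {g : Ω → {k // k ≠ j} → ℝ}
    (h : IsStationaryGaussianVAR P A S y e) (hc : 0 < c) (hC : 0 < C)
    (hS : (S - c • (1 : Matrix (Fin p) (Fin p) ℝ)).PosSemidef)
    (hf : ∀ θ : ℝ, ((C : ℂ) • (1 : Matrix (Fin p) (Fin p) ℂ)
      - varSpectralDensity A S θ).PosSemidef)
    (hB : B = 8 * Real.pi * C * (1 + 2 * Real.pi * C / c)) (hn : 0 < n) (hD : 3 ≤ D)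
    (hDε : 6 * Real.exp (-((D - 3) * Real.log 2)) ≤ ε / 2)
    (hp₀ : 2 ≤ p₀) (hp₀ε : 4 / (p₀ : ℝ) ≤ ε / 4) (hnε : 2 * Real.exp (-(n * 2 : ℝ)) ≤ ε / 4)
    (hlκ : 30 * B * √(Real.log p / n) ≤ l) (hlK : l ≤ K * √(Real.log p / n))
    (hJ : p₀ ≤ p ∨ 1 ≤ nodewiseSparsity (secondMoment P y) j)
    (hsmall : 1 ≤ nodewiseSparsity (secondMoment P y) j →
      nodewiseSparsity (secondMoment P y) j * √(Real.log p / n) ≤ 1 ∧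
      (32 + p₀) * (2 * B * D) * (nodewiseSparsity (secondMoment P y) j * √(Real.log p / n))
        ≤ c / 2)
    (hg : ∀ᵐ ω ∂P, IsNodewiseLasso (designMatrix n y ω) j l (g ω)) :
    P {ω | ¬ ((∑ t, ((designMatrix n y ω).submatrix id Subtype.val).mulVec
          (g ω - nodewiseCoef (secondMoment P y) j) t ^ 2) / n
          ≤ (32 * K ^ 2 + 8 * (5 * B * D + K) ^ 2 * p₀) / c
            * (nodewiseSparsity (secondMoment P y) j * (Real.log p / n)) ∧
        ∑ k, |(g ω - nodewiseCoef (secondMoment P y) j) k|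
          ≤ (32 * K + 4 * (5 * B * D + K) * p₀) / c
            * (nodewiseSparsity (secondMoment P y) j * √(Real.log p / n)))}
      ≤ ENNReal.ofReal ε := by
  have := h.isProb
  have hp2 : 2 ≤ p := by
    rcases hJ with h1 | h1
    · omega
    · exact two_le_of_nodewiseSparsity h1
  have hp2' : (2 : ℝ) ≤ p := by exact_mod_cast hp2
  have hn' : (0 : ℝ) < n := by exact_mod_cast hn
  have hlog2 : 0 < Real.log 2 := Real.log_pos (by norm_num)
  have hlog2p : Real.log 2 ≤ Real.log p := Real.log_le_log (by norm_num) hp2'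
  have hlogp : 0 < Real.log p := hlog2.trans_le hlog2p
  have hr : 0 < √(Real.log p / n) := Real.sqrt_pos.2 (by positivity)
  have hr2 : √(Real.log p / n) ^ 2 = Real.log p / n := Real.sq_sqrt (by positivity)
  set r := √(Real.log p / n) with hrd
  rw [← hr2]
  set Sg := secondMoment P y with hSg
  set q := nodewiseSparsity Sg j with hq
  have hB0 : 0 < B := by rw [hB]; positivity
  have hBC : 8 * Real.pi * C ≤ B := by
    rw [hB]
    exact le_mul_of_one_le_right (by positivity) (le_add_of_nonneg_right (by positivity))
  have hD0 : 0 < D := by linarith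
  have hl : 0 < l := lt_of_lt_of_le (by positivity) hlκ
  have hK : 0 < K := by
    by_contra hK
    exact absurd hlK (not_le.2 (lt_of_le_of_lt
      (mul_nonpos_of_nonpos_of_nonneg (not_lt.1 hK) hr.le) hl))
  have hlow := h.secondMoment_lower hf hS
  have hp₀' : (0 : ℝ) < p₀ := by exact_mod_cast (by omega : 0 < p₀)
  have hε : 0 < ε := by
    have : 0 < 4 / (p₀ : ℝ) := by positivity
    linarith
  have hexpD : ∀ E : ℝ, D - 3 ≤ E →
      Real.exp (-(E * Real.log p)) ≤ Real.exp (-((D - 3) * Real.log 2)) := fun E hE =>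
    Real.exp_le_exp.2 (neg_le_neg (mul_le_mul hE hlog2p hlog2.le (by linarith)))
  -- the noise level, which depends on whether the dimension is large
  obtain ⟨D', hD'1, hD'D, hnoise, hcase⟩ : ∃ D' : ℝ, 1 ≤ D' ∧ D' ≤ D ∧
      4 * Real.exp (-((D' - 2) * Real.log p)) + 2 * Real.exp (-(n * (D' - 1))) ≤ ε / 2 ∧
      (D' = 3 ∨ (p ≤ p₀ ∧ 1 ≤ q)) := by
    by_cases hpp : p₀ ≤ p
    -- At `D' = 3` the noise level is `15 B r`, half of the lower bound `30 B r` on `l`; the failure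
    -- probability is at most `4/p + 2e^{-2n}`, small since `p ≥ p₀`.
    · refine ⟨3, by norm_num, hD, ?_, Or.inl rfl⟩
      have h1 : Real.exp (-((3 - 2) * Real.log p)) = 1 / p := by
        rw [show -((3 - 2) * Real.log p) = -Real.log p by ring, Real.exp_neg,
          Real.exp_log (by linarith), one_div]
      have h2 : 4 * (1 / (p : ℝ)) ≤ 4 / p₀ := by
        rw [mul_one_div]
        have : (p₀ : ℝ) ≤ p := by exact_mod_cast hpp
        gcongr
      have h3 : -(n * (3 - 1) : ℝ) = -(n * 2) := by ring
      rw [h1, h3]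
      linarith
    · refine ⟨D, by linarith, le_rfl, ?_, Or.inr ⟨by omega, hJ.resolve_left hpp⟩⟩
      have h1 := hexpD (D - 2) (by linarith)
      have h2 : Real.exp (-(n * (D - 1))) ≤ Real.exp (-((D - 3) * Real.log 2)) := by
        refine Real.exp_le_exp.2 (neg_le_neg ?_)
        have h3 : Real.log 2 ≤ 1 := by linarith [Real.log_two_lt_d9]
        have h4 : (1 : ℝ) ≤ n := by exact_mod_cast hn
        nlinarith [mul_le_mul_of_nonneg_left h3 (by linarith : 0 ≤ D - 3)]
      linarith
  have hN := (h.measure_noise_gt_le hc hC hS hf hn hp2 j hB hD'1).trans hnoise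
  have hG : 1 ≤ q → P.real {ω | ∃ kl : Fin p × Fin p, 2 * B * D * r
      < |(∑ t, designMatrix n y ω t kl.1 * designMatrix n y ω t kl.2) / n - Sg kl.1 kl.2|}
      ≤ ε / 2 := by
    intro hq1
    have hq1' : (1 : ℝ) ≤ q := by exact_mod_cast hq1
    have hr1 : r ≤ 1 := (le_mul_of_one_le_left hr.le hq1').trans (hsmall hq1).1
    have h1 := h.measure_gram_gt_le hC hf hn hp2 (D := D) hBC hr1
    have h2 := hexpD (D - 3) le_rfl
    have h3 := Real.exp_pos (-((D - 3) * Real.log 2))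
    linarith
  set EN := {ω | ∃ k : {k // k ≠ j}, 5 * B * D' * r < |∑ t, designMatrix n y ω t k *
    (residualDirection Sg j ⬝ᵥ designMatrix n y ω t)| / n} with hEN
  -- The clause `1 ≤ q` empties this event when `q = 0`, where `r ≤ 1` may fail and the Gram matrix
  -- is not controlled.
  set EG := {ω | 1 ≤ q ∧ ∃ kl : Fin p × Fin p, 2 * B * D * r
      < |(∑ t, designMatrix n y ω t kl.1 * designMatrix n y ω t kl.2) / n - Sg kl.1 kl.2|} with hEG
  have hG' : P.real EG ≤ ε / 2 := by
    by_cases hq1 : 1 ≤ q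
    · exact (measureReal_mono fun ω hω => hω.2).trans (hG hq1)
    · have : EG = ∅ := Set.eq_empty_of_forall_notMem fun ω hω => hq1 hω.1
      rw [this, measureReal_empty]; linarith
  have hfin : P (EN ∪ EG) ≤ ENNReal.ofReal ε := by
    rw [← ofReal_measureReal]
    exact ENNReal.ofReal_le_ofReal ((measureReal_union_le _ _).trans (by linarith))
  refine (measure_mono_ae ?_).trans hfin
  filter_upwards [hg] with ω hgω hbad
  by_contra hgood
  refine hbad ?_
  have hgood' : ω ∉ EN ∧ ω ∉ EG := by
    constructor
    · exact fun hh => hgood (Or.inl hh)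
    · exact fun hh => hgood (Or.inr hh)
  have hz : ∀ k, k ≠ j → |∑ t, designMatrix n y ω t k *
      (residualDirection Sg j ⬝ᵥ designMatrix n y ω t)| / n ≤ 5 * B * D' * r := fun k hk => by
    by_contra hh
    exact hgood'.1 ⟨⟨k, hk⟩, not_le.1 hh⟩
  have hgr : 1 ≤ q → ∀ k i, |(∑ t, designMatrix n y ω t k * designMatrix n y ω t i) / n - Sg k i|
      ≤ 2 * B * D * r := fun hq1 k i => by
    by_contra hh
    exact hgood'.2 ⟨hq1, (k, i), not_le.1 hh⟩
  have hq0 : (0 : ℝ) ≤ q := Nat.cast_nonneg _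
  have hδ0 : 0 ≤ 2 * B * D * r := by positivity
  rcases hcase with rfl | ⟨hpp, hq1⟩
  · obtain ⟨hV, hL⟩ := nodewise_rate_of_noise_le hc hlow hl (by linarith) hδ0 hgω hz
      fun hq1 => ⟨hgr hq1, by
        have h1 := (hsmall hq1).2
        have h2 : 0 ≤ p₀ * (2 * B * D) * (q * r) + 16 * (2 * B * D) * (q * r) := by positivity
        linarith⟩
    refine ⟨hV.trans ?_, hL.trans ?_⟩
    · calc 32 * l ^ 2 * q / c ≤ 32 * (K * r) ^ 2 * q / c := by gcongr
        _ = 32 * K ^ 2 / c * (q * r ^ 2) := by ring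
        _ ≤ _ := by
          gcongr
          have : 0 ≤ 8 * (5 * B * D + K) ^ 2 * p₀ := by positivity
          linarith
    · calc 32 * l * q / c ≤ 32 * (K * r) * q / c := by gcongr
        _ = 32 * K / c * (q * r) := by ring
        _ ≤ _ := by
          gcongr
          have : 0 ≤ 4 * (5 * B * D + K) * p₀ := by positivity
          linarith
  · have hq1' : (1 : ℝ) ≤ q := by exact_mod_cast hq1
    have hpp' : (p : ℝ) ≤ p₀ := by exact_mod_cast hpp
    have hz' := fun k hk => (hz k hk).trans
      (by gcongr : 5 * B * D' * r ≤ 5 * B * D * r)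
    obtain ⟨hV, hL⟩ := nodewise_rate_of_dim hc hlow hl.le (by positivity) hδ0 hgω hz' (hgr hq1) (by
      have h1 := (hsmall hq1).2
      have h2 : 2 * B * D * r * p ≤ 2 * B * D * (q * r) * p₀ := by
        have : r ≤ q * r := le_mul_of_one_le_left hr.le hq1'
        gcongr
      have h3 : 0 ≤ 32 * (2 * B * D) * (q * r) := by positivity
      linarith)
    refine ⟨hV.trans ?_, hL.trans ?_⟩
    · calc 8 * (5 * B * D * r + l) ^ 2 * p / c ≤ 8 * (5 * B * D * r + K * r) ^ 2 * p₀ / c := by gcongr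
        _ = 8 * (5 * B * D + K) ^ 2 * p₀ / c * (1 * r ^ 2) := by ring
        _ ≤ _ := by
          gcongr
          have : 0 ≤ 32 * K ^ 2 := by positivity
          linarith
    · calc 4 * (5 * B * D * r + l) * p / c ≤ 4 * (5 * B * D * r + K * r) * p₀ / c := by gcongr
        _ = 4 * (5 * B * D + K) * p₀ / c * (1 * r) := by ring
        _ ≤ _ := by
          gcongr
          have : 0 ≤ 32 * K := by positivity
          linarith

theorem mainTheorem6 (c₀ C₀ : ℝ) (hc₀ : 0 < c₀) (hC₀ : 0 < C₀) :
    ∃ κ : ℝ, 0 < κ ∧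
      ∀ (Ω : ℕ → Type*) [∀ n, MeasurableSpace (Ω n)] (P : ∀ n, Measure (Ω n)) (p : ℕ → ℕ)
        (A S : ∀ n, Matrix (Fin (p n)) (Fin (p n)) ℝ)
        (y e : ∀ n, ℕ → Ω n → EuclideanSpace ℝ (Fin (p n)))
        (lam : ∀ n, Fin (p n) → ℝ)
        (γhat : ∀ n, ∀ j : Fin (p n), Ω n → {k // k ≠ j} → ℝ),
        -- for each sample size, a stable stationary Gaussian VAR(1) model
        (∀ n, IsStationaryGaussianVAR (P n) (A n) (S n) (y n) (e n)) →
        -- uniformly controlled dependence: the eigenvalues of the noise covariance are at least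
        -- `c₀`, those of the spectral density at most `C₀`
        (∀ n, (S n - c₀ • (1 : Matrix (Fin (p n)) (Fin (p n)) ℝ)).PosSemidef) →
        (∀ n, ∀ θ : ℝ, ((C₀ : ℂ) • (1 : Matrix (Fin (p n)) (Fin (p n)) ℂ)
          - varSpectralDensity (A n) (S n) θ).PosSemidef) →
        -- the tuning parameters are of exact order `√(log p / n)`, above the level `κ`
        (∀ᶠ n : ℕ in atTop, ∀ j, κ * √(Real.log (p n) / n) ≤ lam n j) →
        (∃ K : ℝ, ∀ᶠ n : ℕ in atTop, ∀ j, lam n j ≤ K * √(Real.log (p n) / n)) →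
        -- `max_j q_j log p / √n → 0`
        Tendsto (fun n : ℕ =>
          ((Finset.univ.sup (nodewiseSparsity (secondMoment (P n) (y n))) : ℕ) : ℝ)
            * Real.log (p n) / √(n : ℝ)) atTop (𝓝 0) →
        -- `γhat n j` is a nodewise Lasso estimate computed from the `n` observations
        (∀ n j, ∀ᵐ ω ∂(P n),
          IsNodewiseLasso (designMatrix n (y n) ω) j (lam n j) (γhat n j ω)) →
        IsBigOpOn P
            (fun n => {j | Tendsto p atTop atTop ∨
              1 ≤ nodewiseSparsity (secondMoment (P n) (y n)) j})
            (fun n j ω => ∑ k, |γhat n j ω k - nodewiseCoef (secondMoment (P n) (y n)) j k|)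
            (fun n j => nodewiseSparsity (secondMoment (P n) (y n)) j
              * √(Real.log (p n) / n)) ∧
          IsBigOpOn P
            (fun n => {j | Tendsto p atTop atTop ∨
              1 ≤ nodewiseSparsity (secondMoment (P n) (y n)) j})
            (fun n j ω => (∑ t, (nodewiseFit (designMatrix n (y n) ω) j
              (fun k => γhat n j ω k - nodewiseCoef (secondMoment (P n) (y n)) j k) t) ^ 2) / n)
            (fun n j => nodewiseSparsity (secondMoment (P n) (y n)) j
              * (Real.log (p n) / n)) := by
  set B := 8 * Real.pi * C₀ * (1 + 2 * Real.pi * C₀ / c₀) with hB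
  have hB0 : 0 < B := by positivity
  -- Twice the noise level `5 * B * D'` at `D' = 3`; it involves only `c₀` and `C₀`.
  refine ⟨30 * B, by positivity, ?_⟩
  intro Ω _ P p A S y e lam γhat hmodel hS hf hκ hK hq hγ
  obtain ⟨K₀, hK₀⟩ := hK
  set K := max K₀ 1 with hKd
  have hK1 : 0 < K := lt_max_of_lt_right one_pos
  have key : ∀ ε : ℝ, 0 < ε → ∃ M₁ M₂ : ℝ, 0 < M₁ ∧ 0 < M₂ ∧ ∀ᶠ n in atTop,
      ∀ j ∈ {j | Tendsto p atTop atTop ∨ 1 ≤ nodewiseSparsity (secondMoment (P n) (y n)) j},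
      P n {ω | ¬ ((∑ t, ((designMatrix n (y n) ω).submatrix id Subtype.val).mulVec
          (γhat n j ω - nodewiseCoef (secondMoment (P n) (y n)) j) t ^ 2) / n
          ≤ M₁ * (nodewiseSparsity (secondMoment (P n) (y n)) j * (Real.log (p n) / n)) ∧
        ∑ k, |(γhat n j ω - nodewiseCoef (secondMoment (P n) (y n)) j) k|
          ≤ M₂ * (nodewiseSparsity (secondMoment (P n) (y n)) j * √(Real.log (p n) / n)))}
      ≤ ENNReal.ofReal ε := by
    intro ε hε
    have hlog2 : 0 < Real.log 2 := Real.log_pos (by norm_num)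
    obtain ⟨D, hD3, hDε⟩ : ∃ D : ℝ, 3 ≤ D ∧ 6 * Real.exp (-((D - 3) * Real.log 2)) ≤ ε / 2 := by
      have h1 : Tendsto (fun D : ℝ => 6 * Real.exp (-((D - 3) * Real.log 2))) atTop (𝓝 (6 * 0)) :=
        (Real.tendsto_exp_neg_atTop_nhds_zero.comp
          ((tendsto_atTop_add_const_right _ (-3) tendsto_id).atTop_mul_const hlog2)).const_mul 6
      rw [mul_zero] at h1
      obtain ⟨D, h2, h3⟩ := ((h1.eventually_le_const (half_pos hε)).and
        (eventually_ge_atTop 3)).exists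
      exact ⟨D, h3, h2⟩
    obtain ⟨p₀, hp₀, hp₀ε⟩ : ∃ p₀ : ℕ, 2 ≤ p₀ ∧ 4 / (p₀ : ℝ) ≤ ε / 4 := by
      have h1 := tendsto_const_div_atTop_nhds_zero_nat (4 : ℝ)
      obtain ⟨p₀, h2, h3⟩ := ((h1.eventually_le_const (by positivity : 0 < ε / 4)).and
        (eventually_ge_atTop 2)).exists
      exact ⟨p₀, h3, h2⟩
    have hnε : ∀ᶠ n : ℕ in atTop, 2 * Real.exp (-(n * 2 : ℝ)) ≤ ε / 4 := by
      have h1 : Tendsto (fun n : ℕ => 2 * Real.exp (-(n * 2 : ℝ))) atTop (𝓝 (2 * 0)) :=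
        (Real.tendsto_exp_neg_atTop_nhds_zero.comp
          (tendsto_natCast_atTop_atTop.atTop_mul_const two_pos)).const_mul 2
      rw [mul_zero] at h1
      exact h1.eventually_le_const (by positivity)
    have hJ : ∀ᶠ n in atTop, ∀ j, (Tendsto p atTop atTop ∨
        1 ≤ nodewiseSparsity (secondMoment (P n) (y n)) j) →
        (p₀ ≤ p n ∨ 1 ≤ nodewiseSparsity (secondMoment (P n) (y n)) j) := by
      by_cases hp : Tendsto p atTop atTop
      · filter_upwards [hp.eventually_ge_atTop p₀] with n hn j _ using Or.inl hn
      · exact Eventually.of_forall fun n j hj => Or.inr (hj.resolve_left hp)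
    have hD0 : 0 < D := by linarith
    have hsm := hq.div_const (√(Real.log 2))
    rw [zero_div] at hsm
    -- The threshold for `q_j √(log p / n)`: below `1` it gives `√(log p / n) ≤ 1` when `q_j ≥ 1`,
    -- and the second entry makes the Gram error small enough for both regimes.
    have hη : 0 < min 1 (c₀ / 2 / ((32 + p₀) * (2 * B * D))) := by positivity
    refine ⟨(32 * K ^ 2 + 8 * (5 * B * D + K) ^ 2 * p₀) / c₀,
      (32 * K + 4 * (5 * B * D + K) * p₀) / c₀, by positivity, by positivity, ?_⟩
    filter_upwards [hnε, hJ, hsm.eventually_le_const hη, hκ, hK₀, eventually_gt_atTop 0]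
      with n hn1 hn2 hn3 hn4 hn5 hn6 j hj
    refine measure_nodewise_rate_le (hmodel n) hc₀ hC₀ (hS n) (hf n) hB hn6 hD3 hDε hp₀ hp₀ε hn1
      (hn4 j) ((hn5 j).trans (mul_le_mul_of_nonneg_right (le_max_left _ _) (Real.sqrt_nonneg _)))
      (hn2 j hj) (fun hq1 => ?_) (hγ n j)
    have h1 := (nodewiseSparsity_mul_rate_le (n := n) hq1).trans hn3
    refine ⟨h1.trans (min_le_left _ _), ?_⟩
    have h2 := h1.trans (min_le_right _ _)
    rw [le_div_iff₀ (by positivity)] at h2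
    linarith
  constructor
  · intro ε hε
    obtain ⟨M₁, M₂, -, hM₂, hev⟩ := key ε hε
    refine ⟨M₂, hM₂, ?_⟩
    filter_upwards [hev] with n hn j hj
    refine (measure_mono fun ω hω hcon => ?_).trans (hn j hj)
    rw [Set.mem_ofPred_eq, abs_of_nonneg (Finset.sum_nonneg fun _ _ => abs_nonneg _)] at hω
    exact not_le.2 hω hcon.2
  · intro ε hε
    obtain ⟨M₁, M₂, hM₁, -, hev⟩ := key ε hε
    refine ⟨M₁, hM₁, ?_⟩
    filter_upwards [hev] with n hn j hj
    refine (measure_mono fun ω hω hcon => ?_).trans (hn j hj)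
    rw [Set.mem_ofPred_eq, abs_of_nonneg (div_nonneg (Finset.sum_nonneg fun _ _ => sq_nonneg _)
      (Nat.cast_nonneg _))] at hω
    exact not_le.2 hω hcon.1
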